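/- Let $k$ be an algebraically closed field and let $Y=\operatorname{Spec} A$ be a connected affine curve over $k$ with normalization $\bigsqcup_{i=1}^s\mathbb A^1$ ($s\ge 1$), so that $A\subset\tilde A=\prod_{i=1}^s k[x_i]$. Assume that there is a closed point $0\in Y$ such that $Y\setminus\{0\}$ is nonsingular and the points of $\bigsqcup_{i=1}^s\mathbb A^1$ lying over $0$ are exactly the $s$ origins $x_i=0$. For positive integers $w=(w_1,\dots,w_s)$ let $F_w^n\subset A$ ($n\in\mathbb Z$) be the set of all $f=(f_1,\dots,f_s)\in A$ with $w_i\operatorname{ord}_{x_i=0}(f_i)\ge n$ for all $i$; this is a filtration of $A$ with $F_w^n=A$ for $n\le 0$. Let $\mathcal R_w=\sum_{n\in\mathbb Z}F_w^n t^{-n}\subset A[t,t^{-1}]$ be its extended Rees algebra, a $k[t]$-algebra. Then there are positive integers $w_1,\dots,w_s$ such that the family $\pi:\mathscr Y=\operatorname{Spec}\mathcal R_w\to\mathbb A^1=\operatorname{Spec}k[t]$ has the following properties. 1. $\pi$ is flat and of finite presentation, and for every $b\in k$ the fibre $\mathscr Y_b$ is a connected affine curve over $k$ (reduced, of finite type,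 of pure dimension $1$). 2. There is a section $\sigma:\mathbb A^1\to\mathscr Y$ of $\pi$, with closed image, such that $\mathscr Y\setminus\sigma(\mathbb A^1)\to\mathbb A^1$ is smooth, and the number of branches and the $\delta$-invariant of the singularity $(\mathscr Y_b,\sigma(b))$ are the same for all $b\in k$; the number of branches is $s$. Here a singularity with completed local ring $R$ has $r$ branches and $\delta$-invariant $\delta$ if the normalization of $R$ is isomorphic to $\prod_{i=1}^r k[[x_i]]$ and $\dim_k\bigl(\prod_{i=1}^r k[[x_i]]/R\bigr)=\delta<\infty$. 3. For every $b\in k$ with $b\neq 0$ there is an isomorphism of $k$-schemes $\mathscr Y_b\cong Y$. 4. $\mathscr Y_0\cong\operatorname{Spec}A_0$ as $k$-schemes, where $A_0\subset\tilde A=\prod_{i=1}^s k[x_i]$ is a monomial subring, that is, a $k$-subalgebra generated by monomials $x_i^n$ with $n\ge1$, and $\tilde A$ is the normalization of $A_0$. -/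

import Mathlib

open AlgebraicGeometry CategoryTheory CategoryTheory.Limits
open scoped Polynomial PowerSeries LaurentPolynomial

noncomputable section

namespace MonomialDegeneration

universe u

/-- An injective integral ring homomorphism `φ : R → S` such that every element of `S` is a fraction
`φ c / φ a` whose denominator is a non-zero-divisor. When `S` is a finite product of normal domains,
as in all uses below (`∏ k[x_i]` and `∏ k⟦x_i⟧`), this says that `S` is the normalization of `R`,
i.e. the integral closure of `R` in its total ring of fractions. -/
def IsNormalizationMap {R S : Type*} [CommRing R] [CommRing S] (φ : R →+* S) : Prop :=
  Function.Injective φ ∧ φ.IsIntegral ∧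
    ∀ f : S, ∃ a c : R, φ a ∈ nonZeroDivisors S ∧ φ a * f = φ c

section Curve

variable {k : Type u} [Field k] {s : ℕ}

/-- For `A ⊆ ∏ k[x_i]`, the ideal of functions in `A` that vanish at the image of the point
`x_i = a` of the `i`-th affine line under `⨆ 𝔸¹ → Spec A`. -/
def pointIdeal (A : Subalgebra k (Fin s → k[X])) (i : Fin s) (a : k) : Ideal A :=
  RingHom.ker ((Polynomial.evalRingHom a).comp
    ((Pi.evalRingHom (fun _ : Fin s => k[X]) i).comp A.val.toRingHom))

/-- `Y = Spec A` is a curve with normalization `⨆_{i=1}^s 𝔸¹`, whose only possibly singular point is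
the closed point `𝔪`, and the points of the normalization lying over `𝔪` are exactly the `s` origins
(so that `(Y, 𝔪)` has `s` branches, with parameters `x_1, …, x_s`). -/
structure IsRationalCurve (A : Subalgebra k (Fin s → k[X])) (𝔪 : Ideal A) : Prop where
  isMaximal : 𝔪.IsMaximal
  isNormalization : IsNormalizationMap A.val.toRingHom
  pointIdeal_eq_iff : ∀ (i : Fin s) (a : k), pointIdeal A i a = 𝔪 ↔ a = 0
  regular : ∀ (p : Ideal A) [p.IsPrime], p ≠ 𝔪 → IsRegularLocalRing (Localization.AtPrime p)

/-- A monomial subring of `∏ k[x_i]`: a `k`-subalgebra generated by monomials `x_i ^ n`, `n ≥ 1`. -/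
def IsMonomialSubring (A₀ : Subalgebra k (Fin s → k[X])) : Prop :=
  ∃ M : Set (Fin s × ℕ), (∀ x ∈ M, 0 < x.2) ∧
    A₀ = Algebra.adjoin k ((fun x : Fin s × ℕ => Pi.single x.1 (Polynomial.X ^ x.2)) '' M)

end Curve

section Rees

/-- A decreasing multiplicative filtration `F^•` of a `k`-algebra `B`, indexed by `ℤ` with
`F^n = B` for `n ≤ 0`. -/
structure RingFiltration (k B : Type*) [Field k] [CommRing B] [Algebra k B] where
  /-- The `n`-th step of the filtration. -/
  step : ℤ → Submodule k B
  antitone : Antitone step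
  step_nonpos : ∀ n ≤ 0, step n = ⊤
  mul_mem : ∀ {m n : ℤ} {f g : B}, f ∈ step m → g ∈ step n → f * g ∈ step (m + n)

variable {k B : Type*} [Field k] [CommRing B] [Algebra k B]

/-- The extended Rees algebra `∑_n F^n t^{-n} ⊆ B[t, t⁻¹]` of a filtered ring. -/
def reesAlgebra (F : RingFiltration k B) : Subalgebra k B[T;T⁻¹] where
  carrier := {p | ∀ n : ℤ, p.coeff (-n) ∈ F.step n}
  mul_mem' := by
    intro p q hp hq n
    classical
    rw [AddMonoidAlgebra.coeff_mul]
    refine Submodule.sum_mem _ fun a _ => Submodule.sum_mem _ fun b _ => ?_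
    dsimp only
    split_ifs with h
    · have h1 := hp (-a)
      have h2 := hq (-b)
      rw [neg_neg] at h1 h2
      have h4 : n = -a + -b := by omega
      rw [h4]
      exact F.mul_mem h1 h2
    · exact Submodule.zero_mem _
  add_mem' := by
    intro p q hp hq n
    exact Submodule.add_mem _ (hp n) (hq n)
  algebraMap_mem' := by
    intro c n
    by_cases hn : n = 0
    · rw [F.step_nonpos n hn.le]
      exact Submodule.mem_top
    · have : (algebraMap k B[T;T⁻¹] c).coeff (-n) = 0 := by
        rw [AddMonoidAlgebra.coe_algebraMap]
        exact Finsupp.single_eq_of_ne (by omega)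
      rw [this]
      exact Submodule.zero_mem _

theorem T_mem_reesAlgebra (F : RingFiltration k B) :
    (LaurentPolynomial.T 1 : B[T;T⁻¹]) ∈ reesAlgebra F := by
  intro n
  by_cases hn : n ≤ 0
  · rw [F.step_nonpos n hn]
    exact Submodule.mem_top
  · have : (LaurentPolynomial.T 1 : B[T;T⁻¹]).coeff (-n) = 0 := by
      rw [LaurentPolynomial.T]
      exact Finsupp.single_eq_of_ne (by omega)
    rw [this]
    exact Submodule.zero_mem _

/-- The structure map `k[t] → ∑_n F^n t^{-n}`. -/
def reesParameter (F : RingFiltration k B) : k[X] →ₐ[k] reesAlgebra F :=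
  Polynomial.aeval ⟨LaurentPolynomial.T 1, T_mem_reesAlgebra F⟩

/-- The filtration of `A ⊆ ∏ k[x_i]` by weighted order of vanishing: `F^n` consists of the `f ∈ A`
all of whose monomials `x_i ^ m` have weight `w_i m ≥ n`, i.e. `w_i v_i(f) ≥ n` for all `i`. -/
def weightFiltration {s : ℕ} (A : Subalgebra k (Fin s → k[X])) (w : Fin s → ℕ) :
    RingFiltration k A where
  step n :=
    { carrier := {f | ∀ (i : Fin s) (m : ℕ), (f.1 i).coeff m ≠ 0 → n ≤ (w i : ℤ) * m}
      zero_mem' := by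
        intro i m h
        simp at h
      add_mem' := by
        intro f g hf hg i m h
        by_cases h1 : (f.1 i).coeff m = 0
        · by_cases h2 : (g.1 i).coeff m = 0
          · simp [h1, h2] at h
          · exact hg i m h2
        · exact hf i m h1
      smul_mem' := by
        intro c f hf i m h
        refine hf i m fun h1 => h ?_
        simp [h1] }
  antitone := fun _ _ hab _ hf i m h => hab.trans (hf i m h)
  step_nonpos := by
    intro n hn
    rw [eq_top_iff]
    intro f _ i m _
    exact hn.trans (by positivity)
  mul_mem := by
    intro a b f g hf hg i m h
    have h' : ((f.1 i) * (g.1 i)).coeff m ≠ 0 := h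
    rw [Polynomial.coeff_mul] at h'
    obtain ⟨x, hx, hne⟩ := Finset.exists_ne_zero_of_sum_ne_zero h'
    have h1 := hf i x.1 (left_ne_zero_of_mul hne)
    have h2 := hg i x.2 (right_ne_zero_of_mul hne)
    rw [← Finset.HasAntidiagonal.mem_antidiagonal.mp hx]
    push_cast
    linarith

end Rees

section Invariants

/-- The local `k`-algebra `O` is the local ring of a curve singularity with `r` branches and
`δ`-invariant `δ`: the normalization of its completion `R` is `∏_{i=1}^r k⟦x_i⟧`, and
`dim_k (∏ k⟦x_i⟧ / R) = δ`. -/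
def HasBranchesAndDelta (k O : Type*) [Field k] [CommRing O] [IsLocalRing O] [Algebra k O]
    (r δ : ℕ) : Prop :=
  ∃ φ : AdicCompletion (IsLocalRing.maximalIdeal O) O →ₐ[k] (Fin r → k⟦X⟧),
    IsNormalizationMap φ.toRingHom ∧
    Module.Finite k ((Fin r → k⟦X⟧) ⧸ LinearMap.range φ.toLinearMap) ∧
    Module.finrank k ((Fin r → k⟦X⟧) ⧸ LinearMap.range φ.toLinearMap) = δ

variable (k : Type u) [Field k]

/-- The affine line over `k`. -/
abbrev affineLine : Scheme.{u} := Spec (CommRingCat.of k[X])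

/-- The `k`-point `b` of the affine line. -/
def linePoint (b : k) : Spec (CommRingCat.of k) ⟶ affineLine k :=
  Spec.map (CommRingCat.ofHom (Polynomial.evalRingHom b))

/-- The structure morphism of the spectrum of a `k`-algebra. -/
def specStructure (B : Type u) [CommRing B] [Algebra k B] :
    Spec (CommRingCat.of B) ⟶ Spec (CommRingCat.of k) :=
  Spec.map (CommRingCat.ofHom (algebraMap k B))

variable {k}

/-- For a `k`-scheme `f : X ⟶ Spec k`, the ring homomorphism from `k` to the local ring at `x`. -/
def stalkStructure {X : Scheme.{u}} (f : X ⟶ Spec (CommRingCat.of k)) (x : X) :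
    k →+* X.presheaf.stalk x :=
  ((Scheme.ΓSpecIso (CommRingCat.of k)).inv ≫ f.appTop ≫ X.presheaf.germ ⊤ x trivial).hom

/-- The singularity `(X, x)` of the `k`-scheme `X` has `r` branches and `δ`-invariant `δ`. -/
def SchemeHasBranchesAndDelta {X : Scheme.{u}} (f : X ⟶ Spec (CommRingCat.of k)) (x : X)
    (r δ : ℕ) : Prop :=
  letI : Algebra k (X.presheaf.stalk x) := (stalkStructure f x).toAlgebra
  HasBranchesAndDelta k (X.presheaf.stalk x) r δ

/-- A connected affine (reduced, purely one-dimensional) curve over `k`. -/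
structure IsConnectedAffineCurve {X : Scheme.{u}} (f : X ⟶ Spec (CommRingCat.of k)) : Prop where
  isAffine : IsAffine X
  finiteType : LocallyOfFiniteType f
  isReduced : IsReduced X
  connected : ConnectedSpace X
  dim_eq_one : ∀ Z ∈ irreducibleComponents X, topologicalKrullDim Z = 1

/-- The fibre over the `k`-point `b` of a family over the affine line. -/
abbrev fibre {𝒴 : Scheme.{u}} (π : 𝒴 ⟶ affineLine k) (b : k) : Scheme.{u} :=
  pullback π (linePoint k b)

/-- The structure morphism of the fibre over `b` as a `k`-scheme. -/
abbrev fibreStructure {𝒴 : Scheme.{u}} (π : 𝒴 ⟶ affineLine k) (b : k) :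
    fibre π b ⟶ Spec (CommRingCat.of k) :=
  pullback.snd π (linePoint k b)

/-- The `k`-point of the fibre over `b` given by a section `σ`. -/
def sectionPoint {𝒴 : Scheme.{u}} (π : 𝒴 ⟶ affineLine k) (σ : affineLine k ⟶ 𝒴)
    (hσ : σ ≫ π = 𝟙 (affineLine k)) (b : k) : Spec (CommRingCat.of k) ⟶ fibre π b :=
  pullback.lift (linePoint k b ≫ σ) (𝟙 _) (by simp [hσ])

/-- The point `σ(b)` of the fibre over `b`. -/
def sectionAt {𝒴 : Scheme.{u}} (π : 𝒴 ⟶ affineLine k) (σ : affineLine k ⟶ 𝒴)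
    (hσ : σ ≫ π = 𝟙 (affineLine k)) (b : k) : fibre π b :=
  sectionPoint π σ hσ b (⊥ : PrimeSpectrum k)

/-- Isomorphism of `k`-schemes. -/
def IsIsoOver {X Y : Scheme.{u}} (f : X ⟶ Spec (CommRingCat.of k))
    (g : Y ⟶ Spec (CommRingCat.of k)) : Prop :=
  ∃ e : X ≅ Y, e.hom ≫ g = f

variable {s : ℕ}

/-- The total space of the Rees degeneration of `Spec A` with weights `w`. -/
abbrev reesTotal (A : Subalgebra k (Fin s → k[X])) (w : Fin s → ℕ) : Scheme.{u} :=
  Spec (CommRingCat.of (reesAlgebra (weightFiltration A w)))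

/-- The Rees degeneration of `Spec A` with weights `w`, as a family over the affine line. -/
def reesFamily (A : Subalgebra k (Fin s → k[X])) (w : Fin s → ℕ) :
    reesTotal A w ⟶ affineLine k :=
  Spec.map (CommRingCat.ofHom (reesParameter (weightFiltration A w)).toRingHom)

end Invariants

end MonomialDegeneration

end

/-!
The conductor of `A` in `∏ k[x_i]` is supported at the origins, so `A` is *pinched*: for some `N` it
contains `∏ x_i ^ N k[x_i]`, and the components of each of its elements have a common value at the
origins. Everything follows from this one property, because the degeneration preserves
it. In the coordinates `t` and `y_i = x_i t ^ (-w_i)` the extended Rees algebra is a subalgebra of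
`∏ k[t][y_i]` pinched over `k[t]`, and so are its fibres inside `∏ k[y_i]`, with the same `N`. The
module `∏ k[t][y_i] / R_w` is finite and torsion-free, hence free over `k[t]`; its rank is the
common `δ`-invariant of the fibres.

The fibre at `t = 0` is spanned by weighted initial forms. For `w_i = (N + 1) ^ i` the monomials
`x_i ^ m` with `0 < m < N` have distinct weights, so that modulo `∏ x_i ^ N k[x_i]` every initial
form is a multiple of a single monomial, and the fibre is a monomial subring.
-/

noncomputable section

namespace MonomialDegeneration

section Normalization

variable {K R D ι : Type*} [CommRing K] [CommRing R] [CommRing D] [Algebra K R] [Algebra K D]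

theorem isIntegral_of_pow_dvd_mem_range [Finite ι] (φ : R →ₐ[K] (ι → D)) {x : D} {N : ℕ}
    (hN : 0 < N) (hx : ∀ d : D, ∃ c : K, x ∣ d - algebraMap K D c)
    (hφ : ∀ f : ι → D, (∀ i, x ^ N ∣ f i) → f ∈ φ.range) : φ.toRingHom.IsIntegral := by
  let := φ.toRingHom.toAlgebra
  have := Fintype.ofFinite ι
  intro f
  rcases subsingleton_or_nontrivial (ι → D) with h | h
  · exact ⟨Polynomial.X, Polynomial.monic_X, Subsingleton.elim _ _⟩
  have : Nontrivial R := φ.toRingHom.domain_nontrivial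
  have : Nonempty ι := by
    by_contra! hι
    exact not_subsingleton (ι → D) inferInstance
  choose c hc using fun i => hx (f i)
  let p : R[X] := ∏ i, (Polynomial.X - Polynomial.C (algebraMap K R (c i)))
  have hdvd (i : ι) : x ∣ Polynomial.aeval f p i := by
    have hfactor (j : ι) : algebraMap R (ι → D) (algebraMap K R (c j)) i = algebraMap K D (c j) :=
      congrFun (φ.commutes (c j)) i
    simp only [p, map_prod, map_sub, Polynomial.aeval_X, Polynomial.aeval_C, Finset.prod_apply,
      Pi.sub_apply, hfactor]
    exact (hc i).trans (Finset.dvd_prod_of_mem _ (Finset.mem_univ i))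
  obtain ⟨r, hr⟩ := hφ (Polynomial.aeval f p ^ N) fun i => pow_dvd_pow_of_dvd (hdvd i) N
  have hpow : IsIntegral R (Polynomial.aeval f p ^ N) := hr ▸ isIntegral_algebraMap
  refine IsIntegral.of_aeval_monic (Polynomial.monic_prod_X_sub_C _ _) ?_ (hpow.of_pow hN)
  simp [Fintype.card_ne_zero]

theorem isNormalizationMap_of_pow_dvd_mem_range [Finite ι] [IsDomain D] (φ : R →ₐ[K] (ι → D))
    (hinj : Function.Injective φ) {x : D} (hx0 : x ≠ 0) {N : ℕ} (hN : 0 < N)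
    (hx : ∀ d : D, ∃ c : K, x ∣ d - algebraMap K D c)
    (hφ : ∀ f : ι → D, (∀ i, x ^ N ∣ f i) → f ∈ φ.range) :
    IsNormalizationMap φ.toRingHom := by
  refine ⟨hinj, isIntegral_of_pow_dvd_mem_range φ hN hx hφ, fun f => ?_⟩
  obtain ⟨a, ha⟩ : ∃ a, φ a = fun _ => x ^ N := hφ _ fun _ => dvd_rfl
  obtain ⟨c, hc⟩ : ∃ c, φ c = fun i => x ^ N * f i := hφ _ fun _ => dvd_mul_right _ _
  refine ⟨a, c, mem_nonZeroDivisors_iff_right.2 fun g hg => funext fun i => ?_, ?_⟩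
  · have hgi : g i * φ a i = 0 := congrFun hg i
    simpa [ha, hx0] using hgi
  · exact funext fun i => by simp [ha, hc]

end Normalization

theorem dvd_single_apply {ι D : Type*} [DecidableEq ι] [CommRing D] {x y : D} (h : x ∣ y)
    (i j : ι) : x ∣ (Pi.single i y : ι → D) j := by
  rcases eq_or_ne j i with rfl | hji
  · simpa using h
  · simp [hji]

/-- A subalgebra `B` of `∏ K[x_i]` with `∏ x_i ^ N K[x_i] ⊆ B` and all of whose elements take the
same value at all the origins: the coordinate ring of affine lines with the origins pinched
together into one point. Both the Rees algebra (with `K = k[t]`) and its fibres (with `K = k`) have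
this form. -/
structure IsPinched {K ι : Type*} [CommRing K] (N : ℕ) (B : Subalgebra K (ι → K[X])) : Prop where
  pos : 0 < N
  mem_of_dvd : ∀ f : ι → K[X], (∀ i, Polynomial.X ^ N ∣ f i) → f ∈ B
  coeff_zero_eq : ∀ f ∈ B, ∀ i j, (f i).coeff 0 = (f j).coeff 0

section Coordinates

variable {K ι : Type*} [CommRing K] (B : Subalgebra K (ι → K[X])) (i : ι)

/-- The restriction of functions on `Spec B` to the `i`-th affine line. -/
def coord : B →ₐ[K] K[X] :=
  (Pi.evalAlgHom K (fun _ : ι => K[X]) i).comp B.val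

/-- The value of a function on `Spec B` at the origin of the `i`-th affine line. -/
def constCoeff : B →ₐ[K] K :=
  (Polynomial.aeval (0 : K)).comp (coord B i)

/-- The restriction of functions on `Spec B` to the `i`-th affine line without its origin. -/
def branchChart : B →ₐ[K] K[T;T⁻¹] :=
  Polynomial.toLaurentAlg.comp (coord B i)

variable {B i}

theorem constCoeff_apply (f : B) : constCoeff B i f = (f.1 i).coeff 0 :=
  (Polynomial.coeff_zero_eq_aeval_zero _).symm

theorem constCoeff_surjective : Function.Surjective (constCoeff B i) := fun c =>
  ⟨algebraMap K B c, (constCoeff B i).commutes c⟩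

end Coordinates

theorem exists_X_dvd_sub_algebraMap {K : Type*} [CommRing K] (d : K[X]) :
    ∃ c, Polynomial.X ∣ d - algebraMap K K[X] c :=
  ⟨d.coeff 0, Polynomial.X_dvd_sub_C⟩

namespace IsPinched

variable {K ι : Type*} [CommRing K] {N : ℕ} {B : Subalgebra K (ι → K[X])}

theorem isIntegral [Finite ι] (hB : IsPinched N B) : B.val.toRingHom.IsIntegral :=
  isIntegral_of_pow_dvd_mem_range B.val hB.pos exists_X_dvd_sub_algebraMap fun f hf => by
    simpa using hB.mem_of_dvd f hf

theorem isNormalizationMap [Finite ι] [IsDomain K] (hB : IsPinched N B) :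
    IsNormalizationMap B.val.toRingHom :=
  isNormalizationMap_of_pow_dvd_mem_range B.val Subtype.val_injective Polynomial.X_ne_zero hB.pos
    exists_X_dvd_sub_algebraMap fun f hf => by simpa using hB.mem_of_dvd f hf

theorem finiteType [Finite ι] [IsNoetherianRing K] (hB : IsPinched N B) :
    Algebra.FiniteType K B := by
  have hpi : Algebra.FiniteType K (ι → K[X]) :=
    Algebra.FiniteType.trans (S := K[X]) inferInstance inferInstance
  have hB_pi : Algebra.FiniteType B (ι → K[X]) :=
    Algebra.FiniteType.of_restrictScalars_finiteType K B _
  have : Algebra.IsIntegral B (ι → K[X]) := ⟨hB.isIntegral⟩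
  have hfinite : Module.Finite B (ι → K[X]) := Algebra.IsIntegral.finite
  exact ⟨fg_of_fg_of_fg K B (ι → K[X]) hpi.1 hfinite.1 Subtype.val_injective⟩

theorem X_dvd_of_constCoeff_eq_zero (hB : IsPinched N B) {i : ι} {f : B}
    (hf : constCoeff B i f = 0) (j : ι) : Polynomial.X ∣ f.1 j := by
  rw [Polynomial.X_dvd_iff, hB.coeff_zero_eq _ f.2 j i, ← constCoeff_apply, hf]

section BranchCoord

variable [DecidableEq ι]

theorem single_mem (hB : IsPinched N B) (i : ι) {g : K[X]} (hg : Polynomial.X ^ N ∣ g) :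
    Pi.single i g ∈ B :=
  hB.mem_of_dvd _ (dvd_single_apply hg i)

/-- The function on `Spec B` that is `x_i ^ N` on the `i`-th line and vanishes on the others; its
non-vanishing locus is the `i`-th line without its origin. -/
def branchCoord (hB : IsPinched N B) (i : ι) : B :=
  ⟨Pi.single i (Polynomial.X ^ N), hB.single_mem i dvd_rfl⟩

theorem constCoeff_branchCoord (hB : IsPinched N B) (i j : ι) :
    constCoeff B i (hB.branchCoord j) = 0 := by
  rw [constCoeff_apply, ← Polynomial.X_dvd_iff]
  exact dvd_single_apply (dvd_pow_self _ hB.pos.ne') j i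

theorem mem_of_branchCoord_mem [Finite ι] (hB : IsPinched N B) {p : Ideal B} (hp : p.IsPrime)
    (h : ∀ i, hB.branchCoord i ∈ p) {i : ι} {f : B} (hf : constCoeff B i f = 0) : f ∈ p := by
  have := Fintype.ofFinite ι
  choose g hg using hB.X_dvd_of_constCoeff_eq_zero hf
  have hmem (j : ι) : Pi.single j (Polynomial.X ^ N * g j ^ (2 * N)) ∈ B :=
    hB.single_mem j (dvd_mul_right _ _)
  have hpow : f ^ (2 * N) = ∑ j, hB.branchCoord j * ⟨_, hmem j⟩ := by
    ext l : 2
    simp only [SubmonoidClass.coe_pow, branchCoord, AddSubmonoidClass.coe_finsetSum,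
      MulMemClass.coe_mul, ← Pi.single_mul, Pi.pow_apply, Finset.sum_apply, Finset.sum_pi_single,
      Finset.mem_univ, if_true]
    rw [hg l]
    ring
  refine hp.mem_of_pow_mem (2 * N) ?_
  rw [hpow]
  exact Ideal.sum_mem _ fun j _ => Ideal.mul_mem_right _ _ (h j)

theorem isLocalization_branchChart (hB : IsPinched N B) (i : ι) :
    letI := (branchChart B i).toRingHom.toAlgebra
    IsLocalization.Away (hB.branchCoord i) K[T;T⁻¹] := by
  let := (branchChart B i).toRingHom.toAlgebra
  have hmap (f : B) : algebraMap B K[T;T⁻¹] f = Polynomial.toLaurent (f.1 i) := rfl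
  have hcoord : algebraMap B K[T;T⁻¹] (hB.branchCoord i) = LaurentPolynomial.T N := by
    simp [hmap, branchCoord]
  refine IsLocalization.Away.mk _ ?_ (fun q => ?_) fun a b hab => ⟨1, ?_⟩
  · rw [hcoord]
    exact LaurentPolynomial.isUnit_T _
  · obtain ⟨n, f, hf⟩ := LaurentPolynomial.exists_T_pow q
    have hn : n ≤ n * N := Nat.le_mul_of_pos_right _ hB.pos
    refine ⟨n + 1, ⟨_, hB.single_mem i (dvd_mul_right _ (Polynomial.X ^ (n * N - n) * f))⟩, ?_⟩
    simp only [hcoord, hmap, Pi.single_eq_same, map_mul, Polynomial.toLaurent_X_pow, hf,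
      LaurentPolynomial.T_pow]
    rw [mul_comm q (LaurentPolynomial.T _), ← mul_assoc, ← mul_assoc, ← LaurentPolynomial.T_add,
      mul_right_comm, ← LaurentPolynomial.T_add]
    congr 2
    push_cast [Nat.cast_sub hn]
    ring
  · rw [hmap, hmap, Polynomial.toLaurent_inj] at hab
    ext l : 2
    rcases eq_or_ne l i with rfl | hl
    · simp [branchCoord, hab]
    · simp [branchCoord, hl]

end BranchCoord

end IsPinched

section Dimension

theorem krullDimLE_one_of_isIntegral {R S : Type*} [CommRing R] [CommRing S] [Algebra R S]
    [Algebra.IsIntegral R S] (hinj : Function.Injective (algebraMap R S)) [Ring.KrullDimLE 1 S] :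
    Ring.KrullDimLE 1 R := by
  refine Ring.krullDimLE_one_iff.2 fun I hI => or_iff_not_imp_left.2 fun hImin => ?_
  obtain ⟨P, hPI, hP⟩ : ∃ P < I, P.IsPrime := by
    rwa [minimalPrimes_eq_minimals, Set.notMem_ofPred_iff, not_minimal_iff_exists_lt hI] at hImin
  obtain ⟨Q, -, hQ, hQP⟩ := Ideal.exists_ideal_over_prime_of_isIntegral (S := S) P ⊥ (by
    rw [← RingHom.ker_eq_comap_bot, (RingHom.injective_iff_ker_eq_bot _).1 hinj]
    exact bot_le)
  obtain ⟨J, hQJ, hJ, hJI⟩ := Ideal.exists_ideal_over_prime_of_isIntegral (S := S) I Q (by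
    rw [hQP]
    exact hPI.le)
  have hlt : Q < J := hQJ.lt_of_ne (by
    rintro rfl
    exact hPI.ne (hQP.symm.trans hJI))
  have hJmax : J.IsMaximal := by
    refine (Ring.krullDimLE_one_iff.1 ‹_› J hJ).resolve_left ?_
    rw [minimalPrimes_eq_minimals, Set.notMem_ofPred_iff, not_minimal_iff_exists_lt hJ]
    exact ⟨Q, hlt, hQ⟩
  rw [← hJI]
  exact Ideal.isMaximal_comap_of_isIntegral_of_isMaximal J

theorem ringKrullDim_eq_one_of_krullDimLE_one {R : Type*} [CommRing R] [IsDomain R]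
    [Ring.KrullDimLE 1 R] (hR : ¬ IsField R) : ringKrullDim R = 1 := by
  refine eq_of_le_of_not_lt (Ring.krullDimLE_iff.1 ‹_›) fun hlt => hR ?_
  have : Ring.KrullDimLE 0 R := Ring.krullDimLE_iff.2 (Order.le_of_lt_succ hlt)
  exact Ring.KrullDimLE.isField_of_isDomain

theorem ringKrullDim_quotient_ker {R D : Type*} [CommRing R] [CommRing D] [IsDomain D]
    [Ring.KrullDimLE 1 D] (hD : ¬ IsField D) {f : R →+* D} (hf : f.IsIntegral) :
    ringKrullDim (R ⧸ RingHom.ker f) = 1 := by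
  have : Algebra.IsIntegral f.range D := ⟨RingHom.IsIntegral.tower_top f.rangeRestrict _ hf⟩
  have hinj : Function.Injective (algebraMap f.range D) := Subtype.val_injective
  have := krullDimLE_one_of_isIntegral hinj
  rw [ringKrullDim_eq_of_ringEquiv f.quotientKerEquivRange]
  exact ringKrullDim_eq_one_of_krullDimLE_one fun hfield =>
    hD ((Algebra.IsIntegral.isField_iff_isField hinj).1 hfield)

theorem topologicalKrullDim_zeroLocus {R : Type*} [CommRing R] (I : Ideal R) :
    topologicalKrullDim (PrimeSpectrum.zeroLocus (I : Set R)) = ringKrullDim (R ⧸ I) := by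
  have hemb := PrimeSpectrum.isClosedEmbedding_comap_of_surjective _ (Ideal.Quotient.mk I)
    Ideal.Quotient.mk_surjective
  have hrange : Set.range (PrimeSpectrum.comap (Ideal.Quotient.mk I))
      = PrimeSpectrum.zeroLocus (I : Set R) := by
    rw [range_comap_of_surjective _ _ Ideal.Quotient.mk_surjective, Ideal.mk_ker]
  rw [← PrimeSpectrum.topologicalKrullDim_eq_ringKrullDim, ← hrange]
  exact (IsHomeomorph.topologicalKrullDim_eq _ hemb.isEmbedding.toHomeomorph.isHomeomorph).symm

theorem exists_eq_ker_coord_of_mem_minimalPrimes {k ι : Type*} [Finite ι] [CommRing k] [IsDomain k]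
    {B : Subalgebra k (ι → k[X])} {p : Ideal B} (hp : p ∈ minimalPrimes B) :
    ∃ i, p = RingHom.ker (coord B i) := by
  have := Fintype.ofFinite ι
  have hinf : Finset.univ.inf (fun i => RingHom.ker (coord B i)) ≤ p := fun f hf => by
    have hf0 : f = 0 := Subtype.ext <| funext fun i => (Submodule.mem_finsetInf.1 hf) i (by simp)
    exact hf0 ▸ p.zero_mem
  obtain ⟨i, -, hi⟩ := (Ideal.IsPrime.inf_le' hp.1.1).1 hinf
  exact ⟨i, le_antisymm (hp.2 ⟨RingHom.ker_isPrime _, bot_le⟩ hi) hi⟩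

namespace IsPinched

variable {k ι : Type*} [Field k] {N : ℕ} {B : Subalgebra k (ι → k[X])}

theorem ringKrullDim_quotient_ker_coord [Finite ι] (hB : IsPinched N B) (i : ι) :
    ringKrullDim (B ⧸ RingHom.ker (coord B i)) = 1 :=
  ringKrullDim_quotient_ker (Polynomial.not_isField k) (f := (coord B i).toRingHom)
    (RingHom.IsIntegral.trans _ _ hB.isIntegral
      (RingHom.isIntegral_of_surjective (Pi.evalRingHom (fun _ : ι => k[X]) i)
        (Function.surjective_eval i)))

theorem topologicalKrullDim_eq_one [Finite ι] (hB : IsPinched N B) :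
    ∀ Z ∈ irreducibleComponents (PrimeSpectrum B), topologicalKrullDim Z = 1 := by
  intro Z hZ
  rw [← PrimeSpectrum.zeroLocus_minimalPrimes] at hZ
  obtain ⟨p, hp, rfl⟩ := hZ
  obtain ⟨i, rfl⟩ := exists_eq_ker_coord_of_mem_minimalPrimes hp
  exact (topologicalKrullDim_zeroLocus _).trans (hB.ringKrullDim_quotient_ker_coord i)

theorem eq_zero_of_isIdempotentElem (hB : IsPinched N B) {e : B} (he : IsIdempotentElem e) {i : ι}
    (hei : constCoeff B i e = 0) : e = 0 := by
  ext j : 2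
  have hej : IsIdempotentElem (e.1 j) := congrFun (congrArg Subtype.val he) j
  refine (IsIdempotentElem.iff_eq_zero_or_one.1 hej).resolve_right fun h1 => ?_
  exact Polynomial.not_isUnit_X (isUnit_of_dvd_one (h1 ▸ hB.X_dvd_of_constCoeff_eq_zero hei j))

theorem connectedSpace (hB : IsPinched N B) (i : ι) : ConnectedSpace (PrimeSpectrum B) := by
  have : Nontrivial B := (constCoeff B i).toRingHom.domain_nontrivial
  have : PreconnectedSpace (PrimeSpectrum B) := by
    rw [preconnectedSpace_iff_clopen]
    intro U hU
    obtain ⟨e, he, rfl⟩ := PrimeSpectrum.isClopen_iff.1 hU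
    rcases IsIdempotentElem.iff_eq_zero_or_one.1 (he.map (constCoeff B i)) with h | h
    · simp [hB.eq_zero_of_isIdempotentElem he h]
    · have h1 : 1 - e = 0 := hB.eq_zero_of_isIdempotentElem he.one_sub (i := i) (by simp [h])
      simp [← sub_eq_zero.1 h1]
  exact { toNonempty := inferInstance }

end IsPinched

end Dimension

section PowerSeries

variable {K : Type*} [CommRing K]

theorem X_pow_dvd_coe_iff (n : ℕ) (f : K[X]) :
    (PowerSeries.X : K⟦X⟧) ^ n ∣ (f : K⟦X⟧) ↔ Polynomial.X ^ n ∣ f := by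
  rw [PowerSeries.X_pow_dvd_iff, Polynomial.X_pow_dvd_iff]
  simp only [Polynomial.coeff_coe]

theorem X_pow_dvd_sub_trunc (n : ℕ) (f : K⟦X⟧) :
    PowerSeries.X ^ n ∣ f - (PowerSeries.trunc n f : K⟦X⟧) := by
  rw [PowerSeries.X_pow_dvd_iff]
  intro l hl
  simp [PowerSeries.coeff_trunc, hl]

theorem powerSeries_eq_of_forall_X_pow_dvd_sub {f g : K⟦X⟧}
    (h : ∀ n, (PowerSeries.X : K⟦X⟧) ^ n ∣ f - g) : f = g := by
  rw [← sub_eq_zero]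
  ext n
  simpa using PowerSeries.X_pow_dvd_iff.1 (h (n + 1)) n (Nat.lt_succ_self n)

/-- Polynomials as power series, coordinatewise. -/
def toPowerSeries (K ι : Type*) [CommRing K] : (ι → K[X]) →ₐ[K] (ι → K⟦X⟧) :=
  AlgHom.pi fun i =>
    (Polynomial.coeToPowerSeries.algHom K).comp (Pi.evalAlgHom K (fun _ : ι => K[X]) i)

theorem toPowerSeries_apply {ι : Type*} (f : ι → K[X]) (i : ι) :
    toPowerSeries K ι f i = (f i : K⟦X⟧) := by
  simp [toPowerSeries, Polynomial.coeToPowerSeries.algHom_apply]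

end PowerSeries

section Completion

variable {K O ι : Type*} [CommRing K] [CommRing O] [Algebra K O] {I : Ideal O}

theorem evalₐ_eq_mk_of_le {m n : ℕ} (hmn : m ≤ n) {x : AdicCompletion I O} {r : O}
    (h : AdicCompletion.evalₐ I n x = Ideal.Quotient.mk (I ^ n) r) :
    AdicCompletion.evalₐ I m x = Ideal.Quotient.mk (I ^ m) r := by
  obtain ⟨f, rfl⟩ := AdicCompletion.mk_surjective I O x
  rw [AdicCompletion.evalₐ_mk, Ideal.Quotient.eq] at h
  exact (AdicCompletion.evalₐ_mk I m f).trans ((AdicCompletion.Ideal.mk_eq_mk I hmn f).symm.trans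
    (Ideal.Quotient.eq.2 (Ideal.pow_le_pow_right hmn h)))

/-- `φ` extends `ψ : O → ∏ K⟦x_i⟧` continuously to the `I`-adic completion of `O`: if `x` is
congruent to `r ∈ O` modulo `I ^ n`, then `φ x` is congruent to `ψ r` modulo `x_i ^ n`. -/
def IsCompletionExtension (ψ : O →ₐ[K] (ι → K⟦X⟧)) (φ : AdicCompletion I O →ₐ[K] (ι → K⟦X⟧)) :
    Prop :=
  ∀ (n : ℕ) (x : AdicCompletion I O) (r : O),
    AdicCompletion.evalₐ I n x = Ideal.Quotient.mk (I ^ n) r →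
      ∀ i, (PowerSeries.X : K⟦X⟧) ^ n ∣ φ x i - ψ r i

theorem exists_algHom_powerSeries_of_dvd (ψ : O →ₐ[K] K⟦X⟧)
    (hψ : ∀ r ∈ I, (PowerSeries.X : K⟦X⟧) ∣ ψ r) :
    ∃ φ : AdicCompletion I O →ₐ[K] K⟦X⟧, ∀ (n : ℕ) (x : AdicCompletion I O) (r : O),
      AdicCompletion.evalₐ I n x = Ideal.Quotient.mk (I ^ n) r →
        (PowerSeries.X : K⟦X⟧) ^ n ∣ φ x - ψ r := by
  let J : Ideal K⟦X⟧ := Ideal.span {PowerSeries.X}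
  have hJ (n : ℕ) : I ^ n ≤ (J ^ n).comap ψ :=
    (Ideal.pow_right_mono (fun r hr => Ideal.mem_span_singleton.2 (hψ r hr) : I ≤ J.comap ψ)
      n).trans (Ideal.le_comap_pow ψ n)
  let f (n : ℕ) : AdicCompletion I O →ₐ[K] K⟦X⟧ ⧸ J ^ n :=
    (Ideal.quotientMapₐ (J ^ n) ψ (hJ n)).comp ((AdicCompletion.evalₐ I n).restrictScalars K)
  have hf_mk (n : ℕ) (x : AdicCompletion I O) (r : O)
      (hr : AdicCompletion.evalₐ I n x = Ideal.Quotient.mk (I ^ n) r) :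
      f n x = Ideal.Quotient.mk (J ^ n) (ψ r) := by
    change Ideal.quotientMapₐ (J ^ n) ψ (hJ n) (AdicCompletion.evalₐ I n x) = _
    rw [hr]
    rfl
  have hf {m n : ℕ} (hle : m ≤ n) :
      (Ideal.Quotient.factorₐ K (Ideal.pow_le_pow_right hle)).comp (f n) = f m := by
    ext x
    obtain ⟨r, hr⟩ := Ideal.Quotient.mk_surjective (AdicCompletion.evalₐ I n x)
    rw [AlgHom.comp_apply, hf_mk n x r hr.symm, hf_mk m x r (evalₐ_eq_mk_of_le hle hr.symm)]
    rfl
  refine ⟨IsAdicComplete.liftAlgHom J f hf, fun n x r hr => ?_⟩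
  have hmk := IsAdicComplete.mk_liftAlgHom J f hf n x
  rwa [hf_mk n x r hr, Ideal.Quotient.eq, Ideal.span_singleton_pow, Ideal.mem_span_singleton]
    at hmk

theorem exists_isCompletionExtension (ψ : O →ₐ[K] (ι → K⟦X⟧))
    (hψ : ∀ r ∈ I, ∀ i, (PowerSeries.X : K⟦X⟧) ∣ ψ r i) :
    ∃ φ : AdicCompletion I O →ₐ[K] (ι → K⟦X⟧), IsCompletionExtension ψ φ := by
  choose φ hφ using fun i => exists_algHom_powerSeries_of_dvd
    ((Pi.evalAlgHom K (fun _ : ι => K⟦X⟧) i).comp ψ) fun r hr => hψ r hr i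
  exact ⟨AlgHom.pi φ, fun n x r hr i => hφ i n x r hr⟩

/-- The map `ψ : O → ∏ K⟦x_i⟧` exhibits the completion of `O` at `I` as the completion of the
pinched algebra `B` at its pinched point: the `I`-adic topology on `O` is that of the order of
vanishing, `ψ` takes values in `B + ∏ x_i ^ N K⟦x_i⟧`, and all of `B` is attained. -/
structure IsFormalModel (N : ℕ) (B : Subalgebra K (ι → K[X])) (I : Ideal O)
    (ψ : O →ₐ[K] (ι → K⟦X⟧)) : Prop where
  X_dvd_of_mem : ∀ r ∈ I, ∀ i, (PowerSeries.X : K⟦X⟧) ∣ ψ r i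
  mem_pow_of_dvd : ∀ (j : ℕ) (r : O), (∀ i, (PowerSeries.X : K⟦X⟧) ^ (N * j) ∣ ψ r i) → r ∈ I ^ j
  exists_dvd_sub : ∀ r, ∃ b ∈ B, ∀ i, (PowerSeries.X : K⟦X⟧) ^ N ∣ ψ r i - (b i : K⟦X⟧)
  exists_eq : ∀ b ∈ B, ∃ r, ψ r = toPowerSeries K ι b

namespace IsFormalModel

variable {N : ℕ} {B : Subalgebra K (ι → K[X])} {ψ : O →ₐ[K] (ι → K⟦X⟧)}
  {φ : AdicCompletion I O →ₐ[K] (ι → K⟦X⟧)}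

theorem injective (hψ : IsFormalModel N B I ψ) (hN : 0 < N) (hφ : IsCompletionExtension ψ φ) :
    Function.Injective φ := by
  rw [injective_iff_map_eq_zero]
  intro x hx
  refine AdicCompletion.ext_evalₐ fun j => ?_
  obtain ⟨r, hr⟩ := Ideal.Quotient.mk_surjective (AdicCompletion.evalₐ I (N * j) x)
  have hrI : r ∈ I ^ j := hψ.mem_pow_of_dvd j r fun i => by simpa [hx] using hφ _ x r hr.symm i
  rw [evalₐ_eq_mk_of_le (Nat.le_mul_of_pos_left _ hN) hr.symm, map_zero]
  exact Ideal.Quotient.eq_zero_iff_mem.2 hrI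

theorem exists_eq_of_forall_exists_dvd_sub (hψ : IsFormalModel N B I ψ) (hN : 0 < N)
    (hφ : IsCompletionExtension ψ φ) {f : ι → K⟦X⟧}
    (hf : ∀ n, ∃ r : O, ∀ i, (PowerSeries.X : K⟦X⟧) ^ (N * n) ∣ f i - ψ r i) : ∃ x, φ x = f := by
  choose r hr using hf
  have hcauchy (n : ℕ) : r n ≡ r (n + 1) [SMOD (I ^ n • ⊤ : Submodule O O)] := by
    rw [SModEq.sub_mem, smul_eq_mul, Ideal.mul_top]
    refine hψ.mem_pow_of_dvd n _ fun i => ?_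
    have hdvd := dvd_sub ((pow_dvd_pow _ (Nat.mul_le_mul_left N n.le_succ)).trans
      (hr (n + 1) i)) (hr n i)
    simpa [sub_sub_sub_cancel_left] using hdvd
  let x := AdicCompletion.mk I O (AdicCompletion.AdicCauchySequence.mk I O r hcauchy)
  refine ⟨x, funext fun i => powerSeries_eq_of_forall_X_pow_dvd_sub fun n => ?_⟩
  have hdvd := dvd_sub (hφ n x (r n) (AdicCompletion.evalₐ_mk I n _) i)
    ((pow_dvd_pow _ (Nat.le_mul_of_pos_left n hN)).trans (hr n i))
  rwa [sub_sub_sub_cancel_right] at hdvd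

end IsFormalModel

namespace IsPinched

variable {N : ℕ} {B : Subalgebra K (ι → K[X])} {ψ : O →ₐ[K] (ι → K⟦X⟧)}
  {φ : AdicCompletion I O →ₐ[K] (ι → K⟦X⟧)}

theorem mem_iff_exists_dvd_sub (hB : IsPinched N B) (f : ι → K[X]) :
    f ∈ B ↔ ∃ b ∈ B, ∀ i, Polynomial.X ^ N ∣ f i - b i :=
  ⟨fun hf => ⟨f, hf, fun i => by simp⟩, fun ⟨b, hb, hbf⟩ => by
    simpa using B.add_mem (hB.mem_of_dvd (f - b) hbf) hb⟩

theorem mem_range_iff (hB : IsPinched N B) (hψ : IsFormalModel N B I ψ)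
    (hφ : IsCompletionExtension ψ φ) (f : ι → K⟦X⟧) :
    f ∈ φ.range ↔ ∃ b ∈ B, ∀ i, (PowerSeries.X : K⟦X⟧) ^ N ∣ f i - (b i : K⟦X⟧) := by
  constructor
  · rintro ⟨x, rfl⟩
    obtain ⟨r, hr⟩ := Ideal.Quotient.mk_surjective (AdicCompletion.evalₐ I N x)
    obtain ⟨b, hb, hrb⟩ := hψ.exists_dvd_sub r
    exact ⟨b, hb, fun i => by simpa using dvd_add (hφ N x r hr.symm i) (hrb i)⟩
  · rintro ⟨b, hb, hfb⟩
    refine hψ.exists_eq_of_forall_exists_dvd_sub hB.pos hφ fun n => ?_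
    let t : ι → K[X] := fun i => PowerSeries.trunc (N * (n + 1)) (f i)
    have hft (i : ι) : PowerSeries.X ^ (N * (n + 1)) ∣ f i - (t i : K⟦X⟧) :=
      X_pow_dvd_sub_trunc _ _
    have ht : t ∈ B := (hB.mem_iff_exists_dvd_sub t).2 ⟨b, hb, fun i => by
      rw [← X_pow_dvd_coe_iff]
      have hdvd := dvd_sub (hfb i)
        ((pow_dvd_pow _ (Nat.le_mul_of_pos_right N n.succ_pos)).trans (hft i))
      simpa [sub_sub_sub_cancel_left] using hdvd⟩
    obtain ⟨r, hr⟩ := hψ.exists_eq t ht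
    refine ⟨r, fun i => ?_⟩
    rw [hr, toPowerSeries_apply]
    exact (pow_dvd_pow _ (Nat.mul_le_mul_left N n.le_succ)).trans (hft i)

theorem isNormalizationMap_completion [Finite ι] [IsDomain K] (hB : IsPinched N B)
    (hψ : IsFormalModel N B I ψ) (hφ : IsCompletionExtension ψ φ) :
    IsNormalizationMap φ.toRingHom :=
  isNormalizationMap_of_pow_dvd_mem_range φ (hψ.injective hB.pos hφ) PowerSeries.X_ne_zero hB.pos
    (fun d => ⟨PowerSeries.constantCoeff d, by simp [PowerSeries.X_dvd_iff]⟩)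
    fun f hf => (hB.mem_range_iff hψ hφ f).2 ⟨0, B.zero_mem, fun i => by simpa using hf i⟩

theorem nonempty_quotient_equiv (hB : IsPinched N B) {C : Submodule K (ι → K⟦X⟧)}
    (hC : ∀ f, f ∈ C ↔ ∃ b ∈ B, ∀ i, (PowerSeries.X : K⟦X⟧) ^ N ∣ f i - (b i : K⟦X⟧)) :
    Nonempty (((ι → K[X]) ⧸ Subalgebra.toSubmodule B) ≃ₗ[K] (ι → K⟦X⟧) ⧸ C) := by
  let L : (ι → K[X]) →ₗ[K] (ι → K⟦X⟧) ⧸ C := C.mkQ ∘ₗ (toPowerSeries K ι).toLinearMap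
  have hker : Subalgebra.toSubmodule B = LinearMap.ker L := by
    ext f
    simp only [L, LinearMap.mem_ker, LinearMap.comp_apply, Submodule.mkQ_apply,
      Submodule.Quotient.mk_eq_zero, hC, AlgHom.toLinearMap_apply, toPowerSeries_apply,
      ← Polynomial.coe_sub, X_pow_dvd_coe_iff, Subalgebra.mem_toSubmodule,
      ← hB.mem_iff_exists_dvd_sub]
  have hsurj : Function.Surjective L := fun q => by
    obtain ⟨f, rfl⟩ := Submodule.mkQ_surjective _ q
    refine ⟨fun i => PowerSeries.trunc N (f i), ((Submodule.Quotient.eq C).2 ?_).symm⟩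
    refine (hC _).2 ⟨0, B.zero_mem, fun i => ?_⟩
    simpa [toPowerSeries_apply] using X_pow_dvd_sub_trunc N (f i)
  exact ⟨(Submodule.quotEquivOfEq _ _ hker).trans (L.quotKerEquivOfSurjective hsurj)⟩

theorem finite_quotient [Finite ι] (hB : IsPinched N B) :
    Module.Finite K ((ι → K[X]) ⧸ Subalgebra.toSubmodule B) := by
  cases subsingleton_or_nontrivial K
  · have := Module.subsingleton K ((ι → K[X]) ⧸ Subalgebra.toSubmodule B)
    infer_instance
  let g : (ι → Polynomial.degreeLT K N) →ₗ[K] (ι → K[X]) :=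
    LinearMap.pi fun i => (Polynomial.degreeLT K N).subtype ∘ₗ LinearMap.proj i
  have : Module.Finite K (Polynomial.degreeLT K N) :=
    Module.Finite.equiv (Polynomial.degreeLTEquiv K N).symm
  refine Module.Finite.of_surjective ((Subalgebra.toSubmodule B).mkQ ∘ₗ g) fun q => ?_
  obtain ⟨f, rfl⟩ := Submodule.mkQ_surjective _ q
  have hmonic : (Polynomial.X ^ N : K[X]).Monic := Polynomial.monic_X_pow N
  refine ⟨fun i => ⟨f i %ₘ Polynomial.X ^ N, ?_⟩, ((Submodule.Quotient.eq _).2 ?_).symm⟩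
  · rw [Polynomial.mem_degreeLT]
    simpa using Polynomial.degree_modByMonic_lt (f i) hmonic
  · exact hB.mem_of_dvd _ fun i => ⟨f i /ₘ Polynomial.X ^ N,
      sub_eq_of_eq_add' (Polynomial.modByMonic_add_div (f i) _).symm⟩

end IsPinched

end Completion

namespace IsPinched

theorem hasBranchesAndDelta_of_isFormalModel {k O : Type*} [Field k] [CommRing O] [IsLocalRing O]
    [Algebra k O] {s N : ℕ} {B : Subalgebra k (Fin s → k[X])} (hB : IsPinched N B)
    {ψ : O →ₐ[k] (Fin s → k⟦X⟧)} (hψ : IsFormalModel N B (IsLocalRing.maximalIdeal O) ψ) :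
    HasBranchesAndDelta k O s (Module.finrank k ((Fin s → k[X]) ⧸ Subalgebra.toSubmodule B)) := by
  obtain ⟨φ, hφ⟩ := exists_isCompletionExtension ψ hψ.X_dvd_of_mem
  obtain ⟨e⟩ := hB.nonempty_quotient_equiv (C := LinearMap.range φ.toLinearMap)
    (hB.mem_range_iff hψ hφ)
  have := hB.finite_quotient
  exact ⟨φ, hB.isNormalizationMap_completion hψ hφ, Module.Finite.equiv e, e.finrank_eq.symm⟩

section Localization

theorem mem_ker_constCoeff_pow {K ι : Type*} [CommRing K] {N : ℕ} {B : Subalgebra K (ι → K[X])}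
    (hB : IsPinched N B) (i : ι) {f : B} {j : ℕ} (hf : ∀ l, Polynomial.X ^ (N * j) ∣ f.1 l) :
    f ∈ RingHom.ker (constCoeff B i) ^ j := by
  rcases j with _ | j
  · simp
  choose g hg using hf
  have hmem (h : ι → K[X]) : (fun l => Polynomial.X ^ N * h l) ∈ B :=
    hB.mem_of_dvd _ fun l => dvd_mul_right _ _
  have hker (h : ι → K[X]) : (⟨_, hmem h⟩ : B) ∈ RingHom.ker (constCoeff B i) := by
    rw [RingHom.mem_ker, constCoeff_apply, Polynomial.mul_coeff_zero]
    simp [hB.pos.ne]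
  have hfactor : f = (⟨_, hmem 1⟩ : B) ^ j * ⟨_, hmem g⟩ := by
    ext l : 2
    simp only [hg, MulMemClass.coe_mul, SubmonoidClass.coe_pow, Pi.mul_apply, Pi.pow_apply,
      Pi.one_apply, mul_one]
    ring
  rw [hfactor, pow_succ]
  exact Ideal.mul_mem_mul (Ideal.pow_mem_pow (hker 1) j) (hker g)

theorem exists_X_pow_dvd_one_sub_mul {K ι : Type*} [CommRing K] {N : ℕ}
    {B : Subalgebra K (ι → K[X])} (hB : IsPinched N B) {i : ι} {u : B}
    (hu : IsUnit (constCoeff B i u)) (n : ℕ) :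
    ∃ v : B, ∀ j, Polynomial.X ^ n ∣ (1 - u * v).1 j := by
  obtain ⟨c, hc⟩ := hu.exists_right_inv
  let y : B := 1 - u * algebraMap K B c
  have hy : constCoeff B i y = 0 := by
    simp only [y, map_sub, map_one, map_mul, AlgHom.commutes, Algebra.algebraMap_self_apply, hc,
      sub_self]
  refine ⟨algebraMap K B c * ∑ l ∈ Finset.range n, y ^ l, fun j => ?_⟩
  have hgeom : 1 - u * (algebraMap K B c * ∑ l ∈ Finset.range n, y ^ l) = y ^ n := by
    rw [← mul_assoc, show u * algebraMap K B c = 1 - y by simp [y], mul_neg_geom_sum,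
      sub_sub_cancel]
  rw [hgeom]
  exact pow_dvd_pow_of_dvd (hB.X_dvd_of_constCoeff_eq_zero hy j) n

variable {k ι : Type*} [Field k] {N : ℕ} {B : Subalgebra k (ι → k[X])}

theorem isUnit_toPowerSeries (hB : IsPinched N B) {i : ι} {u : B} (hu : constCoeff B i u ≠ 0) :
    IsUnit (toPowerSeries k ι u) := by
  refine Pi.isUnit_iff.2 fun j => PowerSeries.isUnit_iff_constantCoeff.2 ?_
  rw [constCoeff_apply, hB.coeff_zero_eq _ u.2 i j] at hu
  simpa [toPowerSeries_apply] using hu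

theorem isFormalModel_of_isLocalization (hB : IsPinched N B) (i : ι) {O : Type*} [CommRing O]
    [IsLocalRing O] [Algebra k O] [Algebra B O] [IsScalarTower k B O] (p : Ideal B) [p.IsPrime]
    (hp : p = RingHom.ker (constCoeff B i)) [IsLocalization.AtPrime O p]
    {ψ : O →ₐ[k] (ι → k⟦X⟧)} (hψ : ∀ b : B, ψ (algebraMap B O b) = toPowerSeries k ι b) :
    IsFormalModel N B (IsLocalRing.maximalIdeal O) ψ := by
  have hp_iff (b : B) : b ∈ p ↔ constCoeff B i b = 0 := by rw [hp, RingHom.mem_ker]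
  have hdvd {r : O} {a : B} {u : p.primeCompl} (h : r * algebraMap B O u = algebraMap B O a)
      (n : ℕ) (j : ι) : (PowerSeries.X : k⟦X⟧) ^ n ∣ ψ r j ↔ Polynomial.X ^ n ∣ a.1 j := by
    have hmul := congrFun (congrArg ψ h) j
    rw [map_mul, hψ, hψ, Pi.mul_apply] at hmul
    have hunit := Pi.isUnit_iff.1 (hB.isUnit_toPowerSeries (mt (hp_iff u).2 u.2)) j
    rw [← X_pow_dvd_coe_iff, ← toPowerSeries_apply, ← hmul, hunit.dvd_mul_right]
  refine ⟨fun r hr j => ?_, fun n r hr => ?_, fun r => ?_, fun b hb => ⟨_, hψ ⟨b, hb⟩⟩⟩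
  · obtain ⟨⟨a, u⟩, h⟩ := IsLocalization.surj p.primeCompl r
    have ha : a ∈ p := by
      rw [← IsLocalization.AtPrime.to_map_mem_maximal_iff O p a, ← h]
      exact Ideal.mul_mem_right _ _ hr
    rw [← pow_one PowerSeries.X, hdvd h, pow_one]
    exact hB.X_dvd_of_constCoeff_eq_zero ((hp_iff a).1 ha) j
  · obtain ⟨⟨a, u⟩, h⟩ := IsLocalization.surj p.primeCompl r
    have ha : a ∈ p ^ n := by
      rw [hp]
      exact hB.mem_ker_constCoeff_pow i fun l => (hdvd h _ l).1 (hr l)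
    rw [← Ideal.mul_unit_mem_iff_mem _ (IsLocalization.map_units O u), h,
      ← IsLocalization.AtPrime.map_eq_maximalIdeal p O, ← Ideal.map_pow]
    exact Ideal.mem_map_of_mem _ ha
  · obtain ⟨⟨a, u⟩, h⟩ := IsLocalization.surj p.primeCompl r
    obtain ⟨v, hv⟩ := hB.exists_X_pow_dvd_one_sub_mul
      (isUnit_iff_ne_zero.2 (mt (hp_iff u).2 u.2)) N
    refine ⟨(a * v).1, (a * v).2, fun j => ?_⟩
    have hsub : ψ r - toPowerSeries k ι (a * v).1 = ψ r * toPowerSeries k ι (1 - u.1 * v).1 := by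
      rw [← hψ, ← hψ, ← map_sub, ← map_mul, map_sub (algebraMap B O), map_mul (algebraMap B O) a,
        ← h, map_mul (algebraMap B O) u.1, map_one]
      congr 1
      ring
    rw [← toPowerSeries_apply, ← Pi.sub_apply, hsub, Pi.mul_apply, toPowerSeries_apply]
    exact dvd_mul_of_dvd_right ((X_pow_dvd_coe_iff _ _).2 (hv j)) _

theorem hasBranchesAndDelta_of_isLocalization {s : ℕ} {B : Subalgebra k (Fin s → k[X])}
    (hB : IsPinched N B) (i : Fin s) {O : Type*} [CommRing O] [IsLocalRing O] [Algebra k O]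
    [Algebra B O] [IsScalarTower k B O] (p : Ideal B) [p.IsPrime]
    (hp : p = RingHom.ker (constCoeff B i)) [IsLocalization.AtPrime O p] :
    HasBranchesAndDelta k O s (Module.finrank k ((Fin s → k[X]) ⧸ Subalgebra.toSubmodule B)) := by
  have hunit (u : p.primeCompl) :
      IsUnit (((toPowerSeries k (Fin s)).comp B.val : B →ₐ[k] _) u) :=
    hB.isUnit_toPowerSeries (i := i) (by rw [Ne, ← RingHom.mem_ker, ← hp]; exact u.2)
  exact hB.hasBranchesAndDelta_of_isFormalModel (hB.isFormalModel_of_isLocalization i p hp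
    (ψ := IsLocalization.liftAlgHom (M := p.primeCompl) hunit) (IsLocalization.lift_eq hunit))

end Localization

end IsPinched

section Regular

theorem preValuationRing_of_maximalIdeal_eq_span {R : Type*} [CommRing R] [IsLocalRing R]
    [IsNoetherianRing R] {π : R} (hπ : IsLocalRing.maximalIdeal R = Ideal.span {π}) :
    PreValuationRing R := by
  have hassoc (x : R) (hx : x ≠ 0) : ∃ n, Associated (π ^ n) x := by
    have hfin : FiniteMultiplicity π x := by
      by_contra hinf
      refine hx ?_
      rw [← Ideal.mem_bot, ← Ideal.iInf_pow_eq_bot_of_isLocalRing (IsLocalRing.maximalIdeal R)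
        Ideal.IsPrime.ne_top', Ideal.mem_iInf]
      intro n
      rw [hπ, Ideal.span_singleton_pow, Ideal.mem_span_singleton]
      exact FiniteMultiplicity.not_iff_forall.1 hinf n
    obtain ⟨y, hy, hdvd⟩ := hfin.exists_eq_pow_mul_and_not_dvd
    rw [← Ideal.mem_span_singleton, ← hπ, IsLocalRing.notMem_maximalIdeal] at hdvd
    exact ⟨_, hdvd.unit, hy.symm⟩
  refine PreValuationRing.iff_dvd_total.2 ⟨fun x y => ?_⟩
  rcases eq_or_ne x 0 with rfl | hx
  · exact Or.inr (dvd_zero y)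
  rcases eq_or_ne y 0 with rfl | hy
  · exact Or.inl (dvd_zero x)
  obtain ⟨m, hm⟩ := hassoc x hx
  obtain ⟨n, hn⟩ := hassoc y hy
  rw [← hm.dvd_iff_dvd_left, ← hn.dvd_iff_dvd_right, ← hm.dvd_iff_dvd_right,
    ← hn.dvd_iff_dvd_left]
  exact (le_total m n).imp (pow_dvd_pow π) (pow_dvd_pow π)

theorem preValuationRing_of_isRegularLocalRing (R : Type*) [CommRing R] [IsRegularLocalRing R]
    [Ring.KrullDimLE 1 R] : PreValuationRing R := by
  have hrank : (IsLocalRing.maximalIdeal R).spanFinrank ≤ 1 := by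
    have hdim := Ring.krullDimLE_iff.1 ‹Ring.KrullDimLE 1 R›
    rw [← IsRegularLocalRing.spanFinrank_maximalIdeal] at hdim
    exact_mod_cast hdim
  rcases Nat.le_one_iff_eq_zero_or_eq_one.1 hrank with h | h
  · rw [Submodule.spanFinrank_eq_zero_iff_eq_bot (IsNoetherian.noetherian _)] at h
    exact preValuationRing_of_maximalIdeal_eq_span (π := 0) (by rw [h, Ideal.span_singleton_zero])
  · rw [Submodule.spanFinrank_eq_one_iff] at h
    obtain ⟨π, hπ⟩ := h.1.principal
    exact preValuationRing_of_maximalIdeal_eq_span hπ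

theorem krullDimLE_one_localization {R : Type*} [CommRing R] [Ring.KrullDimLE 1 R] (p : Ideal R)
    [p.IsPrime] : Ring.KrullDimLE 1 (Localization.AtPrime p) := by
  rw [Ring.krullDimLE_iff,
    IsLocalization.AtPrime.ringKrullDim_eq_height p (Localization.AtPrime p)]
  exact (Ideal.height_le_ringKrullDim_of_ne_top Ideal.IsPrime.ne_top').trans
    (Ring.krullDimLE_iff.1 ‹_›)

theorem exists_mul_eq_mul_of_localization_dvd {R : Type*} [CommRing R] {p : Ideal R} [p.IsPrime]
    {a b : R} (h : algebraMap R (Localization.AtPrime p) a ∣ algebraMap R _ b) :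
    ∃ u ∉ p, ∃ g, u * b = a * g := by
  obtain ⟨q, hq⟩ := h
  obtain ⟨⟨g, u⟩, hg⟩ := IsLocalization.surj p.primeCompl q
  have heq : algebraMap R (Localization.AtPrime p) (u * b) = algebraMap R _ (a * g) := by
    rw [map_mul, map_mul, hq, ← hg]
    ring
  obtain ⟨v, hv⟩ := (IsLocalization.eq_iff_exists p.primeCompl _).1 heq
  exact ⟨v * u, p.primeCompl.mul_mem v.2 u.2, v * g, by linear_combination hv⟩

theorem exists_mul_mem_range_of_isRegular {R S : Type*} [CommRing R] [CommRing S] [Algebra R S]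
    [Algebra.IsIntegral R S] (hinj : Function.Injective (algebraMap R S)) [Ring.KrullDimLE 1 R]
    (p : Ideal R) [hp : p.IsPrime] [IsRegularLocalRing (Localization.AtPrime p)] {f : S} {a c : R}
    (ha : algebraMap R S a ∈ nonZeroDivisors S) (hf : algebraMap R S a * f = algebraMap R S c) :
    ∃ u ∉ p, algebraMap R S u * f ∈ (algebraMap R S).range := by
  have := krullDimLE_one_localization p
  have := preValuationRing_of_isRegularLocalRing (Localization.AtPrime p)
  rcases ValuationRing.dvd_total (algebraMap R (Localization.AtPrime p) a) (algebraMap R _ c)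
    with h | h <;> obtain ⟨u, hu, g, hg⟩ := exists_mul_eq_mul_of_localization_dvd h <;>
    have hg' := congrArg (algebraMap R S) hg <;> simp only [map_mul] at hg'
  · refine ⟨u, hu, g, (mul_cancel_left_mem_nonZeroDivisors ha).1 ?_⟩
    linear_combination -algebraMap R S u * hf - hg'
  · have hinv : algebraMap R S g * f = algebraMap R S u := by
      rw [← mul_cancel_left_mem_nonZeroDivisors ha]
      linear_combination algebraMap R S g * hf - hg'
    -- `g / u` is inverse to the integral element `f`, so it does not vanish at `p`.
    refine ⟨g, fun hgp => hu ?_, u, hinv.symm⟩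
    obtain ⟨q, -, -, hqp⟩ := Ideal.exists_ideal_over_prime_of_isIntegral (S := S) p ⊥ (by
      rw [← RingHom.ker_eq_comap_bot, (RingHom.injective_iff_ker_eq_bot _).1 hinj]
      exact bot_le)
    rw [← hqp, Ideal.mem_comap] at hgp ⊢
    exact hinv ▸ q.mul_mem_right f hgp

end Regular

section Conductor

/-- The conductor of a subring `A` of `S`: the largest ideal of `S` contained in `A`. -/
def conductorIdeal {R S : Type*} [CommRing R] [CommRing S] [Algebra R S] (A : Subalgebra R S) :
    Ideal S where
  carrier := {h | ∀ f, h * f ∈ A}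
  add_mem' ha hb f := by
    rw [add_mul]
    exact A.add_mem (ha f) (hb f)
  zero_mem' f := by simp
  smul_mem' r h hh f := by
    rw [smul_eq_mul, mul_comm r h, mul_assoc]
    exact hh _

theorem mem_of_mem_conductorIdeal {R S : Type*} [CommRing R] [CommRing S] [Algebra R S]
    {A : Subalgebra R S} {h : S} (hh : h ∈ conductorIdeal A) : h ∈ A := by
  simpa using hh 1

theorem mem_conductorIdeal_of_span_eq_top {R S : Type*} [CommRing R] [CommRing S] [Algebra R S]
    {A : Subalgebra R S} {G : Set S} (hG : Submodule.span A G = ⊤) {h : S}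
    (hh : ∀ g ∈ G, h * g ∈ A) : h ∈ conductorIdeal A := by
  intro f
  have hf : f ∈ Submodule.span A G := hG ▸ Submodule.mem_top
  induction hf using Submodule.span_induction with
  | mem g hg => exact hh g hg
  | zero => simp
  | add x y _ _ hx hy => simpa [mul_add] using A.add_mem hx hy
  | smul a x _ hx =>
    rw [mul_smul_comm]
    exact A.mul_mem a.2 hx

theorem single_mem_of_mem_map_eval {ι : Type*} [DecidableEq ι] {R : ι → Type*}
    [∀ i, CommRing (R i)] {I : Ideal (∀ i, R i)} {i : ι} {g : R i}
    (hg : g ∈ I.map (Pi.evalRingHom R i)) : Pi.single i g ∈ I := by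
  obtain ⟨h, hh, rfl⟩ :=
    (Ideal.mem_map_iff_of_surjective (Pi.evalRingHom R i) (Function.surjective_eval i)).1 hg
  have hsingle : Pi.single i (h i) = h * Pi.single i 1 := by
    rw [← Pi.single_mul_right, mul_one]
  exact hsingle ▸ I.mul_mem_right _ hh

theorem exists_X_pow_mem_of_forall_exists_eval_ne_zero {k : Type*} [Field k] [IsAlgClosed k]
    {J : Ideal k[X]} (hJ : ∀ a ≠ 0, ∃ g ∈ J, g.eval a ≠ 0) : ∃ m, Polynomial.X ^ m ∈ J := by
  obtain ⟨g, hg⟩ := (IsPrincipalIdealRing.principal J).principal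
  have hroot (a : k) (ha : a ∈ g.roots) : a = 0 := by
    by_contra ha0
    obtain ⟨h, hhJ, hha⟩ := hJ a ha0
    rw [hg, Ideal.submodule_span_eq, Ideal.mem_span_singleton] at hhJ
    exact hha (Polynomial.eval_eq_zero_of_dvd_of_eval_eq_zero hhJ
      (Polynomial.isRoot_of_mem_roots ha))
  have hg0 : g ≠ 0 := by
    rintro rfl
    simpa [hg] using hJ 1 one_ne_zero
  refine ⟨g.roots.card, ?_⟩
  rw [hg, Ideal.submodule_span_eq, Ideal.mem_span_singleton]
  refine (IsAlgClosed.splits g).dvd_of_roots_le_roots hg0 ?_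
  rw [Polynomial.roots_pow, Polynomial.roots_X, Multiset.nsmul_singleton]
  exact (Multiset.eq_replicate.2 ⟨rfl, hroot⟩).le

end Conductor

namespace IsRationalCurve

variable {k : Type*} [Field k] {s : ℕ} {A : Subalgebra k (Fin s → k[X])} {𝔪 : Ideal A}

theorem mem_pointIdeal {i : Fin s} {a : k} {f : A} : f ∈ pointIdeal A i a ↔ (f.1 i).eval a = 0 :=
  Iff.rfl

theorem coeff_zero_eq (hA : IsRationalCurve A 𝔪) (f : Fin s → k[X]) (hf : f ∈ A) (i j : Fin s) :
    (f i).coeff 0 = (f j).coeff 0 := by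
  have hpoint : pointIdeal A i 0 = pointIdeal A j 0 :=
    ((hA.pointIdeal_eq_iff i 0).2 rfl).trans ((hA.pointIdeal_eq_iff j 0).2 rfl).symm
  have hi : ⟨f, hf⟩ - algebraMap k A ((f i).coeff 0) ∈ pointIdeal A i 0 := by
    simp [mem_pointIdeal, Polynomial.coeff_zero_eq_eval_zero]
  have hj : (f j).eval 0 - (f i).coeff 0 = 0 := by
    simpa [hpoint, mem_pointIdeal] using hi
  rw [Polynomial.coeff_zero_eq_eval_zero (f j), sub_eq_zero.1 hj]

theorem exists_mem_conductorIdeal (hA : IsRationalCurve A 𝔪) {p : Ideal A} [p.IsPrime]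
    (hp : p ≠ 𝔪) : ∃ u ∉ p, u.1 ∈ conductorIdeal A := by
  have := hA.regular p hp
  have : Algebra.IsIntegral A (Fin s → k[X]) := ⟨hA.isNormalization.2.1⟩
  have : Ring.KrullDimLE 1 A :=
    krullDimLE_one_of_isIntegral (S := Fin s → k[X]) Subtype.val_injective
  have : Algebra.FiniteType k (Fin s → k[X]) :=
    Algebra.FiniteType.trans (S := k[X]) inferInstance inferInstance
  have : Algebra.FiniteType A (Fin s → k[X]) :=
    Algebra.FiniteType.of_restrictScalars_finiteType k A _
  obtain ⟨G, hG⟩ := (Algebra.IsIntegral.finite : Module.Finite A (Fin s → k[X])).1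
  have hlocal (f : Fin s → k[X]) : ∃ u ∉ p, u.1 * f ∈ A := by
    obtain ⟨a, c, ha, hac⟩ := hA.isNormalization.2.2 f
    obtain ⟨u, hu, g, hg⟩ := exists_mul_mem_range_of_isRegular (S := Fin s → k[X])
      Subtype.val_injective p ha hac
    exact ⟨u, hu, (show g.1 = u.1 * f from hg) ▸ g.2⟩
  choose u hup hu using hlocal
  refine ⟨∏ g ∈ G, u g, p.primeCompl.prod_mem fun g _ => hup g,
    mem_conductorIdeal_of_span_eq_top hG fun g hg => ?_⟩
  classical
  rw [← Finset.prod_erase_mul _ _ (Finset.mem_coe.1 hg), MulMemClass.coe_mul, mul_assoc]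
  exact A.mul_mem (Subtype.property _) (hu g)

theorem exists_single_X_pow_mem_conductorIdeal [IsAlgClosed k] (hA : IsRationalCurve A 𝔪)
    (i : Fin s) : ∃ m, Pi.single i (Polynomial.X ^ m) ∈ conductorIdeal A := by
  have hnonzero (a : k) (ha : a ≠ 0) :
      ∃ g ∈ (conductorIdeal A).map (Pi.evalRingHom _ i), g.eval a ≠ 0 := by
    have : (pointIdeal A i a).IsPrime := RingHom.ker_isPrime _
    obtain ⟨u, hu, hcond⟩ := hA.exists_mem_conductorIdeal (mt (hA.pointIdeal_eq_iff i a).1 ha)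
    exact ⟨u.1 i, Ideal.mem_map_of_mem (Pi.evalRingHom _ i) hcond, hu⟩
  obtain ⟨m, hm⟩ := exists_X_pow_mem_of_forall_exists_eval_ne_zero hnonzero
  exact ⟨m, single_mem_of_mem_map_eval hm⟩

theorem exists_isPinched [IsAlgClosed k] (hA : IsRationalCurve A 𝔪) : ∃ N, IsPinched N A := by
  choose m hm using hA.exists_single_X_pow_mem_conductorIdeal
  refine ⟨1 + ∑ i, m i, by omega, fun f hf => mem_of_mem_conductorIdeal ?_, hA.coeff_zero_eq⟩
  rw [← Finset.univ_sum_single f]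
  refine Ideal.sum_mem _ fun i _ => ?_
  have hle : m i ≤ 1 + ∑ i, m i :=
    (Finset.single_le_sum (fun _ _ => Nat.zero_le _) (Finset.mem_univ i)).trans
      (Nat.le_add_left _ _)
  obtain ⟨q, hq⟩ := (pow_dvd_pow _ hle).trans (hf i)
  rw [hq, Pi.single_mul]
  exact Ideal.mul_mem_right _ _ (hm i)

theorem pos (hA : IsRationalCurve A 𝔪) : 0 < s := by
  refine Nat.pos_of_ne_zero fun hs => hA.isMaximal.ne_top ?_
  subst hs
  exact Subsingleton.elim _ _

end IsRationalCurve

section WeightSubst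

variable {R : Type*} [CommRing R]

theorem coeff_C_mul_T {S : Type*} [Semiring S] (a : S) (n l : ℤ) :
    (LaurentPolynomial.C a * LaurentPolynomial.T n).coeff l = if n = l then a else 0 := by
  rw [← LaurentPolynomial.single_eq_C_mul_T, AddMonoidAlgebra.coeff_single, Finsupp.single_apply]

/-- The substitution `R[t][y] → R[x][T, T⁻¹]` with `t ↦ T` and `y ↦ x T ^ (-w)`, which introduces
the homogeneous coordinate `y` of weight `w` on the family. -/
def weightSubst (R : Type*) [CommRing R] (w : ℕ) : R[X][X] →+* R[X][T;T⁻¹] :=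
  Polynomial.eval₂RingHom
    (Polynomial.eval₂RingHom (LaurentPolynomial.C.comp Polynomial.C) (LaurentPolynomial.T 1))
    (LaurentPolynomial.C Polynomial.X * LaurentPolynomial.T (-w))

theorem weightSubst_monomial (w m j : ℕ) (c : R) :
    weightSubst R w (Polynomial.monomial m (Polynomial.monomial j c)) =
      LaurentPolynomial.C (Polynomial.monomial m c) * LaurentPolynomial.T (j - w * m) := by
  simp only [weightSubst, Polynomial.coe_eval₂RingHom, Polynomial.eval₂_monomial,
    RingHom.comp_apply, LaurentPolynomial.T_pow, mul_pow, ← map_pow]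
  rw [← Polynomial.C_mul_X_pow_eq_monomial, map_mul, sub_eq_add_neg, LaurentPolynomial.T_add,
    mul_one, mul_mul_mul_comm]
  congr 3
  ring

theorem weightSubst_C_monomial (w j : ℕ) (c : R) :
    weightSubst R w (Polynomial.C (Polynomial.monomial j c)) =
      LaurentPolynomial.C (Polynomial.C c) * LaurentPolynomial.T j := by
  rw [← Polynomial.monomial_zero_left, weightSubst_monomial, Polynomial.monomial_zero_left,
    Nat.cast_zero, mul_zero, sub_zero]

theorem coeff_weightSubst (w : ℕ) (g : R[X][X]) (n : ℤ) (m : ℕ) :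
    ((weightSubst R w g).coeff n).coeff m =
      if 0 ≤ n + w * m then (g.coeff m).coeff (n + w * m).toNat else 0 := by
  induction g using Polynomial.induction_on' with
  | add p q hp hq =>
    rw [map_add, AddMonoidAlgebra.coeff_add, Finsupp.add_apply, Polynomial.coeff_add, hp, hq]
    split_ifs <;> simp
  | monomial l a =>
    induction a using Polynomial.induction_on' with
    | add p q hp hq =>
      rw [map_add, map_add, AddMonoidAlgebra.coeff_add, Finsupp.add_apply, Polynomial.coeff_add,
        hp, hq]
      split_ifs <;> simp
    | monomial j c =>
      rw [weightSubst_monomial, coeff_C_mul_T]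
      grind [Polynomial.coeff_monomial, Polynomial.coeff_zero]

theorem coeff_coeff_weightSubst (w : ℕ) (g : R[X][X]) (m j : ℕ) :
    ((weightSubst R w g).coeff (j - w * m)).coeff m = (g.coeff m).coeff j := by
  rw [coeff_weightSubst, sub_add_cancel, if_pos (Int.natCast_nonneg j), Int.toNat_natCast]

theorem weightSubst_injective (w : ℕ) : Function.Injective (weightSubst R w) := fun g h hgh => by
  ext m j
  rw [← coeff_coeff_weightSubst w, hgh, coeff_coeff_weightSubst]

end WeightSubst

section HomogeneousPart

variable {R ι : Type*} [CommRing R] (w : ι → ℕ)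

/-- The substitutions `y_i ↦ x_i T ^ (-w_i)` on all the factors of `∏ R[t][y_i]` together. -/
def weightSubsts : (ι → R[X][X]) →+* (ι → R[X][T;T⁻¹]) :=
  RingHom.pi fun i => (weightSubst R (w i)).comp (Pi.evalRingHom (fun _ => R[X][X]) i)

theorem weightSubsts_injective : Function.Injective (weightSubsts (R := R) w) := fun _ _ h =>
  funext fun i => weightSubst_injective (w i) (congrFun h i)

/-- The component of weighted degree `n` of an element of `∏ R[t][y_i]`: after substituting
`y_i = x_i T ^ (-w_i)`, the coefficient of `T ^ (-n)`. -/
def homogeneousPart (n : ℤ) : (ι → R[X][X]) →+ (ι → R[X]) where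
  toFun g i := (weightSubst R (w i) (g i)).coeff (-n)
  map_zero' := funext fun i => by simp
  map_add' g h := funext fun i => by simp

/-- All monomials `x_i ^ m` occurring in `f` have weight `w_i m ≥ n`; this is the condition which
defines the weight filtration. -/
def HasWeightGE (n : ℤ) (f : ι → R[X]) : Prop :=
  ∀ i m, (f i).coeff m ≠ 0 → n ≤ w i * m

/-- The element of `∏ R[t][y_i]` corresponding to `f T ^ (-n)`, each monomial `x_i ^ m` being
replaced by `t ^ (w_i m - n) y_i ^ m`. The truncation of the exponent at `0` is harmless if `f`
satisfies `HasWeightGE w n`. -/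
def homogenize (n : ℤ) (f : ι → R[X]) : ι → R[X][X] := fun i =>
  ∑ m ∈ (f i).support,
    Polynomial.monomial m (Polynomial.monomial (w i * m - n).toNat ((f i).coeff m))

variable {w}

theorem homogeneousPart_apply (n : ℤ) (g : ι → R[X][X]) (i : ι) :
    homogeneousPart w n g i = (weightSubsts w g i).coeff (-n) :=
  rfl

theorem coeff_homogeneousPart (n : ℤ) (g : ι → R[X][X]) (i : ι) (m : ℕ) :
    (homogeneousPart w n g i).coeff m =
      if n ≤ w i * m then ((g i).coeff m).coeff (w i * m - n).toNat else 0 :=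
  (coeff_weightSubst ..).trans (by simp only [neg_add_eq_sub, sub_nonneg])

theorem coeff_homogenize (n : ℤ) (f : ι → R[X]) (i : ι) (m : ℕ) :
    (homogenize w n f i).coeff m = Polynomial.monomial (w i * m - n).toNat ((f i).coeff m) := by
  simp +contextual [homogenize, Polynomial.coeff_monomial]

theorem hasWeightGE_homogeneousPart (n : ℤ) (g : ι → R[X][X]) :
    HasWeightGE w n (homogeneousPart w n g) := fun i m h => by
  rw [coeff_homogeneousPart] at h
  exact (ite_ne_right_iff.1 h).1

theorem homogeneousPart_homogenize {n : ℤ} {f : ι → R[X]} (hf : HasWeightGE w n f) (l : ℤ) :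
    homogeneousPart w l (homogenize w n f) = if l = n then f else 0 := by
  ext i m
  rw [coeff_homogeneousPart, coeff_homogenize, Polynomial.coeff_monomial]
  by_cases hfm : (f i).coeff m = 0
  · split_ifs <;> simp [hfm]
  have hle := hf i m hfm
  have hzero : ((0 : ι → R[X]) i).coeff m = 0 := rfl
  grind

theorem homogeneousPart_monomial_smul (n : ℤ) (j : ℕ) (c : R) (g : ι → R[X][X]) :
    homogeneousPart w n (Polynomial.monomial j c • g) = c • homogeneousPart w (n + j) g := by
  ext1 i
  have hsubst : weightSubsts w (Polynomial.monomial j c • g) i =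
      AddMonoidAlgebra.single (j : ℤ) (Polynomial.C c) * weightSubsts w g i := by
    rw [Algebra.smul_def, map_mul, Pi.mul_apply, LaurentPolynomial.single_eq_C_mul_T,
      ← weightSubst_C_monomial (w i)]
    rfl
  rw [homogeneousPart_apply, hsubst, AddMonoidAlgebra.coeff_single_mul_apply, ← neg_add_rev,
    Pi.smul_apply, homogeneousPart_apply, Polynomial.smul_eq_C_mul]

theorem homogeneousPart_smul (n : ℤ) (q : R[X]) (g : ι → R[X][X]) :
    homogeneousPart w n (q • g) =
      ∑ j ∈ Finset.range (q.natDegree + 1), q.coeff j • homogeneousPart w (n + j) g := by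
  conv_lhs => rw [q.as_sum_range, Finset.sum_smul, map_sum]
  exact Finset.sum_congr rfl fun j _ => homogeneousPart_monomial_smul ..

theorem homogeneousPart_ext {g h : ι → R[X][X]}
    (hgh : ∀ n, homogeneousPart w n g = homogeneousPart w n h) : g = h := by
  apply weightSubsts_injective w
  ext i n : 2
  rw [← neg_neg n, ← homogeneousPart_apply, hgh, homogeneousPart_apply]

theorem finite_homogeneousPart_ne_zero [Finite ι] (g : ι → R[X][X]) :
    {n | homogeneousPart w n g ≠ 0}.Finite := by
  refine (Set.finite_iUnion fun i => (weightSubst R (w i) (g i)).coeff.hasFiniteSupport.preimage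
    neg_injective.injOn).subset fun n hn => ?_
  obtain ⟨i, hi⟩ := Function.ne_iff.1 hn
  exact Set.mem_iUnion.2 ⟨i, hi⟩

theorem sum_homogenize_homogeneousPart [Finite ι] (g : ι → R[X][X]) :
    ∑ n ∈ (finite_homogeneousPart_ne_zero (w := w) g).toFinset,
      homogenize w n (homogeneousPart w n g) = g :=
  homogeneousPart_ext (w := w) fun l => by
    simp +contextual [map_sum, homogeneousPart_homogenize, hasWeightGE_homogeneousPart, eq_comm]

end HomogeneousPart

section ReesModel

variable {R ι : Type*} [CommRing R] (A : Subalgebra R (ι → R[X])) (w : ι → ℕ)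

/-- The inclusion of `A[T, T⁻¹]` into `∏ R[x_i][T, T⁻¹]`, for `A ⊆ ∏ R[x_i]`. -/
def laurentCoords : A[T;T⁻¹] →+* (ι → R[X][T;T⁻¹]) :=
  RingHom.pi fun i => AddMonoidAlgebra.mapRingHom ℤ (coord A i).toRingHom

variable {A} in
theorem coeff_laurentCoords (p : A[T;T⁻¹]) (i : ι) (n : ℤ) :
    (laurentCoords A p i).coeff n = (p.coeff n).1 i := by
  simp [laurentCoords, coord]

theorem laurentCoords_injective : Function.Injective (laurentCoords A) := fun p q h => by
  ext n i : 3
  rw [← coeff_laurentCoords, h, coeff_laurentCoords]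

theorem weightSubsts_algebraMap (q : R[X]) :
    weightSubsts w (algebraMap R[X] (ι → R[X][X]) q) =
      laurentCoords A (Polynomial.aeval (LaurentPolynomial.T 1) q) := by
  induction q using Polynomial.induction_on' with
  | add p q hp hq => simp only [map_add, hp, hq]
  | monomial n c =>
    have haeval : Polynomial.aeval (LaurentPolynomial.T 1 : A[T;T⁻¹]) (Polynomial.monomial n c) =
        LaurentPolynomial.C (algebraMap R A c) * LaurentPolynomial.T n := by
      rw [Polynomial.aeval_monomial, LaurentPolynomial.T_pow, mul_one]
      rfl
    ext i l : 2
    refine (congrArg (fun q => q.coeff l) (weightSubst_C_monomial (w i) n c)).trans ?_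
    rw [haeval, coeff_laurentCoords, coeff_C_mul_T, coeff_C_mul_T]
    split_ifs <;> rfl

/-- The extended Rees algebra of the weight filtration on `A`, in terms of the parameter `t` and the
homogeneous coordinates `y_i = x_i t ^ (-w_i)`, as a subalgebra of `∏ R[t][y_i]`. -/
def reesModel : Subalgebra R[X] (ι → R[X][X]) where
  __ := (laurentCoords A).rangeS.comap (weightSubsts w)
  algebraMap_mem' q := ⟨Polynomial.aeval (LaurentPolynomial.T 1 : A[T;T⁻¹]) q,
    (weightSubsts_algebraMap A w q).symm⟩

variable {A w}

theorem weightSubsts_homogenize {n : ℤ} {f : A} (hf : HasWeightGE w n f.1) :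
    weightSubsts w (homogenize w n f.1) = laurentCoords A (AddMonoidAlgebra.single (-n) f) := by
  ext i l : 2
  rw [coeff_laurentCoords, ← neg_neg l, ← homogeneousPart_apply, homogeneousPart_homogenize hf,
    AddMonoidAlgebra.coeff_single, Finsupp.single_apply]
  simp only [neg_inj, eq_comm (a := n)]
  split_ifs <;> rfl

theorem homogenize_mem_reesModel {n : ℤ} {f : ι → R[X]} (hf : f ∈ A) (hfn : HasWeightGE w n f) :
    homogenize w n f ∈ reesModel A w :=
  ⟨_, (weightSubsts_homogenize (f := ⟨f, hf⟩) hfn).symm⟩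

theorem mem_reesModel_iff [Finite ι] {g : ι → R[X][X]} :
    g ∈ reesModel A w ↔ ∀ n : ℤ, homogeneousPart w n g ∈ A := by
  constructor
  · rintro ⟨p, hp⟩ n
    have hpn : (p.coeff (-n)).1 = homogeneousPart w n g := funext fun i => by
      rw [← coeff_laurentCoords, hp, homogeneousPart_apply]
    exact hpn ▸ (p.coeff (-n)).2
  · intro hg
    rw [← sum_homogenize_homogeneousPart (w := w) g]
    exact sum_mem fun n _ => homogenize_mem_reesModel (hg n) (hasWeightGE_homogeneousPart n g)

theorem isPinched_reesModel [Finite ι] {N : ℕ} (hA : IsPinched N A) :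
    IsPinched N (reesModel A w) where
  pos := hA.pos
  mem_of_dvd g hg := mem_reesModel_iff.2 fun n => hA.mem_of_dvd _ fun i =>
    Polynomial.X_pow_dvd_iff.2 fun m hm => by
      rw [coeff_homogeneousPart, Polynomial.X_pow_dvd_iff.1 (hg i) m hm, Polynomial.coeff_zero,
        ite_self]
  coeff_zero_eq g hg i j := by
    ext n
    simpa [coeff_homogeneousPart] using hA.coeff_zero_eq _ (mem_reesModel_iff.1 hg (-n)) i j

theorem mem_reesModel_of_smul_mem {k : Type*} [Field k] [Finite ι] {A : Subalgebra k (ι → k[X])}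
    {q : k[X]} (hq : q ≠ 0) {g : ι → k[X][X]} (hg : q • g ∈ reesModel A w) : g ∈ reesModel A w := by
  rw [mem_reesModel_iff] at hg ⊢
  by_contra! hnot
  obtain ⟨n, hn, hmin⟩ := Set.exists_min_image {n | homogeneousPart w n g ∉ A} id
    ((finite_homogeneousPart_ne_zero (w := w) g).subset fun n hn h => hn (h ▸ A.zero_mem)) hnot
  have hsum := hg (n - q.natDegree)
  rw [homogeneousPart_smul, Finset.sum_range_succ, sub_add_cancel] at hsum
  have hlower : ∑ j ∈ Finset.range q.natDegree,
      q.coeff j • homogeneousPart w (n - q.natDegree + j) g ∈ A := sum_mem fun j hj => by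
    refine A.smul_mem (by_contra fun h => ?_) _
    have hle : n ≤ n - q.natDegree + j := hmin _ h
    have hlt := Finset.mem_range.1 hj
    omega
  have htop : q.leadingCoeff • homogeneousPart w n g ∈ A.toSubmodule :=
    (Submodule.add_mem_iff_right A.toSubmodule hlower).1 hsum
  exact hn ((Submodule.smul_mem_iff A.toSubmodule (Polynomial.leadingCoeff_ne_zero.2 hq)).1 htop)

end ReesModel

section ReesEquiv

variable {k : Type*} [Field k] {s : ℕ} {A : Subalgebra k (Fin s → k[X])} {w : Fin s → ℕ}

theorem mem_reesAlgebra_iff {p : A[T;T⁻¹]} : p ∈ reesAlgebra (weightFiltration A w) ↔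
    laurentCoords A p ∈ (weightSubsts w).rangeS := by
  constructor
  · intro hp
    rw [← AddMonoidAlgebra.sum_coeff_single p, Finsupp.sum, map_sum]
    refine sum_mem fun n _ => ⟨homogenize w (-n) (p.coeff n).1, ?_⟩
    have hn : HasWeightGE w (-n) (p.coeff n).1 := by
      have hstep := hp (-n)
      rwa [neg_neg] at hstep
    rw [weightSubsts_homogenize hn, neg_neg]
  · rintro ⟨g, hg⟩ n i m h
    rw [← coeff_laurentCoords, ← hg, ← homogeneousPart_apply] at h
    exact hasWeightGE_homogeneousPart n g i m h

variable (A w) in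
theorem map_laurentCoords_reesAlgebra :
    (reesAlgebra (weightFiltration A w)).toSubsemiring.map (laurentCoords A) =
      (reesModel A w).toSubsemiring.map (weightSubsts w) := by
  have hrees : (reesAlgebra (weightFiltration A w)).toSubsemiring =
      (weightSubsts w).rangeS.comap (laurentCoords A) :=
    Subsemiring.ext fun _ => mem_reesAlgebra_iff
  have hmodel : (reesModel A w).toSubsemiring = (laurentCoords A).rangeS.comap (weightSubsts w) :=
    rfl
  rw [hrees, hmodel, Subsemiring.map_comap_eq, Subsemiring.map_comap_eq, inf_comm]

variable (A w) in
/-- The identification of the extended Rees algebra with its description in homogeneous coordinates: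
both are the intersection of `A[T, T⁻¹]` and `∏ k[t][y_i]` in `∏ k[x_i][T, T⁻¹]`. -/
def reesEquiv : reesAlgebra (weightFiltration A w) ≃+* reesModel A w :=
  ((Subsemiring.equivMapOfInjective _ _ (laurentCoords_injective A)).trans
    (RingEquiv.subsemiringCongr (map_laurentCoords_reesAlgebra A w))).trans
    (Subsemiring.equivMapOfInjective _ _ (weightSubsts_injective w)).symm

theorem weightSubsts_reesEquiv (r : reesAlgebra (weightFiltration A w)) :
    weightSubsts w (reesEquiv A w r).1 = laurentCoords A r.1 :=
  congrArg Subtype.val ((Subsemiring.equivMapOfInjective (reesModel A w).toSubsemiring _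
    (weightSubsts_injective w)).apply_symm_apply _)

theorem reesEquiv_reesParameter (q : k[X]) :
    reesEquiv A w (reesParameter (weightFiltration A w) q) = algebraMap k[X] (reesModel A w) q := by
  apply Subtype.ext
  apply weightSubsts_injective w
  rw [weightSubsts_reesEquiv]
  refine Eq.trans ?_ (weightSubsts_algebraMap A w q).symm
  congr 1
  exact (Polynomial.aeval_algHom_apply (reesAlgebra (weightFiltration A w)).val
    ⟨LaurentPolynomial.T 1, T_mem_reesAlgebra _⟩ q).symm

end ReesEquiv

section Specialization

variable {R ι : Type*} [CommRing R]

/-- Specialization `t = b` from `∏ R[t][y_i]` to `∏ R[y_i]`. -/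
def specialize (b : R) : (ι → R[X][X]) →+* (ι → R[X]) :=
  (Polynomial.mapRingHom (Polynomial.evalRingHom b)).compLeft ι

theorem coeff_specialize (b : R) (g : ι → R[X][X]) (i : ι) (m : ℕ) :
    (specialize b g i).coeff m = ((g i).coeff m).eval b :=
  Polynomial.coeff_map ..

theorem specialize_algebraMap (b : R) (q : R[X]) :
    specialize b (algebraMap R[X] (ι → R[X][X]) q) = algebraMap R (ι → R[X]) (q.eval b) :=
  funext fun _ => Polynomial.map_C _

theorem specialize_smul (b : R) (q : R[X]) (g : ι → R[X][X]) :
    specialize b (q • g) = q.eval b • specialize b g := by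
  rw [Algebra.smul_def, map_mul, specialize_algebraMap, ← Algebra.smul_def]

theorem specialize_map_C (b : R) (f : ι → R[X]) :
    specialize b (fun i => (f i).map Polynomial.C) = f := by
  ext i m
  rw [coeff_specialize, Polynomial.coeff_map, Polynomial.eval_C]

theorem exists_eq_smul_of_specialize_eq_zero {b : R} {g : ι → R[X][X]}
    (hg : specialize b g = 0) : ∃ h, g = (Polynomial.X - Polynomial.C b) • h := by
  have hdvd (i : ι) : Polynomial.C (Polynomial.X - Polynomial.C b) ∣ g i := by
    rw [Polynomial.C_dvd_iff_dvd_coeff]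
    intro m
    rw [Polynomial.dvd_iff_isRoot, Polynomial.IsRoot, ← coeff_specialize, hg]
    rfl
  choose h hh using hdvd
  exact ⟨h, funext fun i => by rw [hh i, Pi.smul_apply, Polynomial.smul_eq_C_mul]⟩

end Specialization

section ReesFibre

variable {R ι : Type*} [CommRing R] (A : Subalgebra R (ι → R[X])) (w : ι → ℕ) (b : R)

/-- The coordinate ring of the fibre of the Rees degeneration over `t = b`, as a subalgebra of
`∏ R[y_i]`. -/
def reesFibre : Subalgebra R (ι → R[X]) where
  __ := (reesModel A w).toSubsemiring.map (specialize b)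
  algebraMap_mem' c := ⟨algebraMap R[X] _ (Polynomial.C c), (reesModel A w).algebraMap_mem _, by
    rw [specialize_algebraMap, Polynomial.eval_C]⟩

/-- The restriction of functions on the total space of the Rees degeneration to the fibre over
`t = b`. -/
def toReesFibre : reesModel A w →+* reesFibre A w b :=
  ((specialize b).comp (reesModel A w).val.toRingHom).codRestrict (reesFibre A w b)
    fun g => ⟨g.1, g.2, rfl⟩

variable {A w b}

theorem isPinched_reesFibre [Finite ι] {N : ℕ} (hA : IsPinched N A) :
    IsPinched N (reesFibre A w b) where
  pos := hA.pos
  mem_of_dvd f hf := by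
    refine ⟨_, (isPinched_reesModel hA).mem_of_dvd _ fun i => ?_, specialize_map_C b f⟩
    simpa using Polynomial.map_dvd Polynomial.C (hf i)
  coeff_zero_eq f hf i j := by
    obtain ⟨g, hg, rfl⟩ := hf
    rw [coeff_specialize, coeff_specialize, (isPinched_reesModel hA).coeff_zero_eq g hg i j]

theorem toReesFibre_surjective : Function.Surjective (toReesFibre A w b) := by
  rintro ⟨f, g, hg, rfl⟩
  exact ⟨⟨g, hg⟩, rfl⟩

theorem toReesFibre_algebraMap (q : R[X]) :
    toReesFibre A w b (algebraMap R[X] (reesModel A w) q) =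
      algebraMap R (reesFibre A w b) (q.eval b) :=
  Subtype.ext (specialize_algebraMap b q)

theorem ker_toReesFibre {k : Type*} [Field k] [Finite ι] (A : Subalgebra k (ι → k[X]))
    (w : ι → ℕ) (b : k) : RingHom.ker (toReesFibre A w b) =
      Ideal.span {algebraMap k[X] (reesModel A w) (Polynomial.X - Polynomial.C b)} := by
  ext g
  rw [RingHom.mem_ker, Ideal.mem_span_singleton']
  constructor
  · intro hg
    have hg0 : specialize b g.1 = 0 := congrArg Subtype.val hg
    obtain ⟨h, hh⟩ := exists_eq_smul_of_specialize_eq_zero hg0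
    have hmem : h ∈ reesModel A w :=
      mem_reesModel_of_smul_mem (Polynomial.X_sub_C_ne_zero b) (hh ▸ g.2)
    refine ⟨⟨h, hmem⟩, Subtype.ext ?_⟩
    change h * algebraMap k[X] (ι → k[X][X]) (Polynomial.X - Polynomial.C b) = g.1
    rw [hh, mul_comm, Algebra.smul_def]
  · rintro ⟨h, rfl⟩
    rw [map_mul, toReesFibre_algebraMap, Polynomial.eval_sub, Polynomial.eval_X, Polynomial.eval_C,
      sub_self, map_zero, mul_zero]

end ReesFibre

section GeneralFibre

variable {k ι : Type*} [Field k] {A : Subalgebra k (ι → k[X])} {w : ι → ℕ} {b : k}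

/-- The rescaling `x_i ↦ b ^ w_i x_i` of `∏ k[x_i]`. -/
def rescale (w : ι → ℕ) (b : k) : (ι → k[X]) →ₐ[k] (ι → k[X]) :=
  AlgHom.pi fun i => (Polynomial.aeval (Polynomial.C (b ^ w i) * Polynomial.X : k[X])).comp
    (Pi.evalAlgHom k (fun _ : ι => k[X]) i)

theorem coeff_rescale (f : ι → k[X]) (i : ι) (m : ℕ) :
    (rescale w b f i).coeff m = (f i).coeff m * (b ^ w i) ^ m :=
  Polynomial.comp_C_mul_X_coeff

theorem rescale_injective (hb : b ≠ 0) : Function.Injective (rescale w b) := fun f g hfg => by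
  ext i m
  refine mul_right_cancel₀ (pow_ne_zero m (pow_ne_zero (w i) hb)) ?_
  rw [← coeff_rescale, hfg, coeff_rescale]

theorem specialize_homogenize (hb : b ≠ 0) {n : ℤ} {f : ι → k[X]} (hf : HasWeightGE w n f) :
    specialize b (homogenize w n f) = b ^ (-n) • rescale w b f := by
  ext i m
  rw [coeff_specialize, coeff_homogenize, Polynomial.eval_monomial, Pi.smul_apply,
    Polynomial.coeff_smul, coeff_rescale, smul_eq_mul, mul_left_comm, ← pow_mul]
  by_cases hfm : (f i).coeff m = 0
  · rw [hfm, zero_mul, zero_mul]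
  · rw [← zpow_natCast, ← zpow_natCast, ← zpow_add₀ hb, Int.toNat_of_nonneg (by grind [hf i m hfm])]
    congr 2
    push_cast
    ring

theorem reesFibre_eq_map_rescale [Finite ι] (hb : b ≠ 0) :
    reesFibre A w b = A.map (rescale w b) := by
  ext f
  constructor
  · rintro ⟨g, hg, rfl⟩
    rw [← sum_homogenize_homogeneousPart (w := w) g, map_sum]
    refine sum_mem fun n _ => ?_
    rw [specialize_homogenize hb (hasWeightGE_homogeneousPart n g)]
    exact Subalgebra.smul_mem _ (Subalgebra.mem_map.2 ⟨_, mem_reesModel_iff.1 hg n, rfl⟩) _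
  · rintro ⟨f, hf, rfl⟩
    have hf0 : HasWeightGE w 0 f := fun _ _ _ => by positivity
    refine ⟨_, homogenize_mem_reesModel hf hf0, ?_⟩
    rw [specialize_homogenize hb hf0, neg_zero, zpow_zero, one_smul]
    rfl

variable (A w) in
/-- Away from `t = 0`, the rescaling `x_i ↦ b ^ w_i x_i` identifies `A` with the fibre over `b`. -/
def reesFibreEquiv [Finite ι] (hb : b ≠ 0) : A ≃ₐ[k] reesFibre A w b :=
  (A.equivMapOfInjective _ (rescale_injective hb)).trans
    (Subalgebra.equivOfEq _ _ (reesFibre_eq_map_rescale hb).symm)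

end GeneralFibre

section SpecialFibre

/-- No two distinct monomials `x_i ^ m` and `x_j ^ l` with exponents less than `N` and `m > 0` have
the same weight. For such weights the initial forms of the elements of `A` are monomials, up to
terms of exponent at least `N`. -/
def SeparatesMonomials {ι : Type*} (N : ℕ) (w : ι → ℕ) : Prop :=
  ∀ ⦃i j : ι⦄ ⦃m l : ℕ⦄, 0 < m → m < N → l < N → w i * m = w j * l → i = j ∧ m = l

theorem separatesMonomials_pow (N s : ℕ) :
    SeparatesMonomials N fun i : Fin s => (N + 1) ^ (i : ℕ) := by
  have hlt {i j l m : ℕ} (hij : i < j) (hl : 0 < l) (hm : m < N) :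
      (N + 1) ^ i * m < (N + 1) ^ j * l :=
    calc (N + 1) ^ i * m < (N + 1) ^ i * (N + 1) :=
          Nat.mul_lt_mul_of_pos_left (by omega) (by positivity)
      _ = (N + 1) ^ (i + 1) := (pow_succ _ _).symm
      _ ≤ (N + 1) ^ j := Nat.pow_le_pow_right (by omega) hij
      _ ≤ (N + 1) ^ j * l := Nat.le_mul_of_pos_right _ hl
  intro i j m l hm hmN hlN h
  have hl : 0 < l := by
    by_contra! hl
    simp [Nat.le_zero.1 hl, hm.ne'] at h
  rcases lt_trichotomy (i : ℕ) j with hij | hij | hij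
  · exact absurd h (hlt hij hl hmN).ne
  · obtain rfl := Fin.ext hij
    exact ⟨rfl, Nat.eq_of_mul_eq_mul_left (by positivity) h⟩
  · exact absurd h (hlt hij hm hlN).ne'

theorem coeff_specialize_zero {R ι : Type*} [CommRing R] (w : ι → ℕ) (g : ι → R[X][X]) (i : ι)
    (m : ℕ) : (specialize 0 g i).coeff m = (homogeneousPart w (w i * m) g i).coeff m := by
  rw [coeff_specialize, coeff_homogeneousPart, if_pos le_rfl, sub_self, Int.toNat_zero,
    Polynomial.coeff_zero_eq_eval_zero]

theorem exists_mem_reesFibre_zero_coeff_eq {R ι : Type*} [CommRing R] [Finite ι]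
    {A : Subalgebra R (ι → R[X])} {w : ι → ℕ} {f : ι → R[X]} (hf : f ∈ reesFibre A w 0) (n : ℤ) :
    ∃ h ∈ reesFibre A w 0, ∀ i m, (h i).coeff m = if w i * m = n then (f i).coeff m else 0 := by
  obtain ⟨g, hg, rfl⟩ := hf
  have hgn := hasWeightGE_homogeneousPart (w := w) n g
  refine ⟨_, ⟨_, homogenize_mem_reesModel (mem_reesModel_iff.1 hg n) hgn, rfl⟩, fun i m => ?_⟩
  rw [coeff_specialize_zero w, coeff_specialize_zero w, homogeneousPart_homogenize hgn]
  split_ifs with h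
  · rw [h]
  · rfl

variable {k ι : Type*} [Field k] [DecidableEq ι] {N : ℕ}

theorem single_mem_reesFibre_zero [Finite ι] {A : Subalgebra k (ι → k[X])} {w : ι → ℕ}
    (hA : IsPinched N A) (hw : SeparatesMonomials N w) {f : ι → k[X]} (hf : f ∈ reesFibre A w 0)
    {i : ι} {m : ℕ} (hm : 0 < m) (hfm : (f i).coeff m ≠ 0) :
    Pi.single i (Polynomial.X ^ m) ∈ reesFibre A w 0 := by
  have hB : IsPinched N (reesFibre A w 0) := isPinched_reesFibre hA
  rcases le_or_gt N m with hNm | hmN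
  · exact hB.single_mem i (pow_dvd_pow _ hNm)
  obtain ⟨h, hh, hcoeff⟩ := exists_mem_reesFibre_zero_coeff_eq hf (w i * m)
  have hdiff : h - (f i).coeff m • (Pi.single i (Polynomial.X ^ m) : ι → k[X]) ∈
      reesFibre A w 0 := by
    refine hB.mem_of_dvd _ fun j => Polynomial.X_pow_dvd_iff.2 fun l hl => ?_
    rw [Pi.sub_apply, Pi.smul_apply, Polynomial.coeff_sub, Polynomial.coeff_smul, hcoeff]
    rcases eq_or_ne j i with rfl | hji
    · rw [Pi.single_eq_same, Polynomial.coeff_X_pow]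
      rcases eq_or_ne l m with rfl | hlm
      · simp
      · rw [if_neg, if_neg hlm, smul_zero, sub_zero]
        exact fun h => hlm (hw hm hmN hl (by exact_mod_cast h.symm)).2.symm
    · rw [if_neg, Pi.single_eq_of_ne hji, Polynomial.coeff_zero, smul_zero, sub_zero]
      exact fun h => hji (hw hm hmN hl (by exact_mod_cast h.symm)).1.symm
  have hsmul := sub_mem hh hdiff
  rw [sub_sub_cancel] at hsmul
  exact ((reesFibre A w 0).toSubmodule.smul_mem_iff hfm).1 hsmul

theorem eq_sum_coeff_smul_single [Fintype ι] (f : ι → k[X]) :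
    f = ∑ i, ∑ m ∈ (f i).support, (f i).coeff m • Pi.single i (Polynomial.X ^ m) := by
  conv_lhs => rw [← Finset.univ_sum_single f]
  refine Finset.sum_congr rfl fun i _ => ?_
  change LinearMap.single k _ i (f i) = ∑ m ∈ _, _ • LinearMap.single k (fun _ => k[X]) i _
  conv_lhs => rw [(f i).as_sum_support_C_mul_X_pow]
  simp only [map_sum, ← Polynomial.smul_eq_C_mul, map_smul]

theorem IsPinched.isMonomialSubring {s : ℕ} {B : Subalgebra k (Fin s → k[X])} (hB : IsPinched N B)
    (i₀ : Fin s) (hmonomial : ∀ f ∈ B, ∀ i m, 0 < m → (f i).coeff m ≠ 0 →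
      Pi.single i (Polynomial.X ^ m) ∈ B) : IsMonomialSubring B := by
  refine ⟨{x | 0 < x.2 ∧ Pi.single x.1 (Polynomial.X ^ x.2) ∈ B}, fun x hx => hx.1,
    le_antisymm (fun f hf => ?_) (Algebra.adjoin_le ?_)⟩
  · rw [← sub_add_cancel f (algebraMap k _ ((f i₀).coeff 0))]
    refine add_mem ?_ (Subalgebra.algebraMap_mem _ _)
    set h := f - algebraMap k (Fin s → k[X]) ((f i₀).coeff 0)
    have hh : h ∈ B := sub_mem hf (B.algebraMap_mem _)
    have hh0 (i : Fin s) : (h i).coeff 0 = 0 := by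
      rw [hB.coeff_zero_eq h hh i i₀]
      simp [h]
    rw [eq_sum_coeff_smul_single h]
    refine sum_mem fun i _ => sum_mem fun m hm => Subalgebra.smul_mem _ ?_ _
    have hhm := Polynomial.mem_support_iff.1 hm
    have hm0 : 0 < m := Nat.pos_of_ne_zero fun h0 => hhm (h0 ▸ hh0 i)
    exact Algebra.subset_adjoin ⟨(i, m), ⟨hm0, hmonomial h hh i m hm0 hhm⟩, rfl⟩
  · rintro _ ⟨x, hx, rfl⟩
    exact hx.2

theorem isMonomialSubring_reesFibre_zero {s : ℕ} {A : Subalgebra k (Fin s → k[X])}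
    {w : Fin s → ℕ} (hA : IsPinched N A) (hw : SeparatesMonomials N w) (i₀ : Fin s) :
    IsMonomialSubring (reesFibre A w 0) :=
  (isPinched_reesFibre hA).isMonomialSubring i₀ fun _ hf _ _ hm hfm =>
    single_mem_reesFibre_zero hA hw hf hm hfm

end SpecialFibre

section ConstantDelta

theorem finrank_eq_of_semilinearMap {R F Q V : Type*} [CommRing R] [Field F] {τ : R →+* F}
    [RingHomSurjective τ] [AddCommGroup Q] [Module R Q] [Module.Free R Q] [Module.Finite R Q]
    [AddCommGroup V] [Module F V] (φ : Q →ₛₗ[τ] V) (hφ : Function.Surjective φ)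
    (hker : ∀ x, φ x = 0 → ∃ a, τ a = 0 ∧ ∃ y, x = a • y) :
    Module.finrank F V = Module.finrank R Q := by
  have : Nontrivial R := τ.domain_nontrivial
  let e := Module.Free.chooseBasis R Q
  have hspan : Submodule.span F (Set.range (φ ∘ e)) = ⊤ := by
    rw [Set.range_comp, ← Submodule.map_span, e.span_eq, Submodule.map_top,
      LinearMap.range_eq_top.2 hφ]
  have hindep : LinearIndependent F (φ ∘ e) := by
    refine Fintype.linearIndependent_iff.2 fun c hc i => ?_
    choose r hr using fun i => RingHomSurjective.is_surjective (σ := τ) (c i)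
    have hφr : φ (∑ i, r i • e i) = 0 := by
      rw [map_sum, ← hc]
      exact Finset.sum_congr rfl fun i _ => by rw [map_smulₛₗ, hr, Function.comp_apply]
    obtain ⟨a, ha, y, hy⟩ := hker _ hφr
    have hri : r i = a * e.repr y i := by
      rw [← e.repr_sum_self r, hy, map_smul, Finsupp.smul_apply, smul_eq_mul]
    rw [← hr, hri, map_mul, ha, zero_mul]
  rw [Module.finrank_eq_card_basis (Module.Basis.mk hindep hspan.ge),
    Module.finrank_eq_card_basis e]

variable {k ι : Type*} [Field k] {A : Subalgebra k (ι → k[X])} {w : ι → ℕ}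

variable (A w) in
/-- Specialization `t = b` from `∏ k[t][y_i]` modulo the Rees algebra to `∏ k[y_i]` modulo the
coordinate ring of the fibre, semilinear over `t ↦ b`. -/
def specializeQuotient (b : k) :
    ((ι → k[X][X]) ⧸ (reesModel A w).toSubmodule) →ₛₗ[Polynomial.evalRingHom b]
      ((ι → k[X]) ⧸ (reesFibre A w b).toSubmodule) :=
  Submodule.mapQ _ _
    { toFun := specialize b
      map_add' := map_add _
      map_smul' := specialize_smul b }
    fun g hg => ⟨g, hg, rfl⟩

theorem specializeQuotient_surjective (b : k) :
    Function.Surjective (specializeQuotient A w b) := fun x => by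
  obtain ⟨f, rfl⟩ := Submodule.mkQ_surjective _ x
  exact ⟨Submodule.Quotient.mk fun i => (f i).map Polynomial.C,
    congrArg Submodule.Quotient.mk (specialize_map_C b f)⟩

theorem exists_eq_smul_of_specializeQuotient_eq_zero {b : k}
    {x : (ι → k[X][X]) ⧸ (reesModel A w).toSubmodule} (hx : specializeQuotient A w b x = 0) :
    ∃ y, x = (Polynomial.X - Polynomial.C b) • y := by
  obtain ⟨g, rfl⟩ := Submodule.mkQ_surjective _ x
  obtain ⟨g', hg', hgg'⟩ := (Submodule.Quotient.mk_eq_zero _).1 hx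
  obtain ⟨h, hh⟩ := exists_eq_smul_of_specialize_eq_zero (b := b) (g := g - g') (by
    rw [map_sub, hgg']
    exact sub_self _)
  refine ⟨Submodule.Quotient.mk h, ?_⟩
  rw [← Submodule.Quotient.mk_smul, ← hh]
  exact (Submodule.Quotient.eq _).2 (by rwa [sub_sub_cancel])

instance isTorsionFree_quotient_reesModel [Finite ι] :
    Module.IsTorsionFree k[X] ((ι → k[X][X]) ⧸ (reesModel A w).toSubmodule) := by
  refine Module.IsTorsionFree.of_smul_eq_zero fun q x hqx => or_iff_not_imp_left.2 fun hq => ?_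
  obtain ⟨g, rfl⟩ := Submodule.mkQ_surjective _ x
  rw [← map_smul, Submodule.mkQ_apply, Submodule.Quotient.mk_eq_zero] at hqx
  rw [Submodule.mkQ_apply, Submodule.Quotient.mk_eq_zero]
  exact mem_reesModel_of_smul_mem hq hqx

theorem finrank_quotient_reesFibre [Finite ι] {N : ℕ} (hA : IsPinched N A) (b : k) :
    Module.finrank k ((ι → k[X]) ⧸ (reesFibre A w b).toSubmodule) =
      Module.finrank k[X] ((ι → k[X][X]) ⧸ (reesModel A w).toSubmodule) := by
  have : Module.Finite k[X] ((ι → k[X][X]) ⧸ (reesModel A w).toSubmodule) :=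
    (isPinched_reesModel hA).finite_quotient
  have : RingHomSurjective (Polynomial.evalRingHom b) := ⟨fun c => ⟨Polynomial.C c, by simp⟩⟩
  exact finrank_eq_of_semilinearMap (specializeQuotient A w b) (specializeQuotient_surjective b)
    fun x hx => ⟨_, by simp, exists_eq_smul_of_specializeQuotient_eq_zero hx⟩

end ConstantDelta

universe u

section Stalks

variable {X : Scheme.{u}} {B : Type u} [CommRing B]

/-- The homomorphism from `B` to the local ring of `X` at `x` given by a morphism `X ⟶ Spec B`. -/
def toStalk (g : X ⟶ Spec (CommRingCat.of B)) (x : X) : B →+* X.presheaf.stalk x :=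
  ((Scheme.ΓSpecIso (CommRingCat.of B)).inv ≫ g.appTop ≫ X.presheaf.germ ⊤ x trivial).hom

theorem toStalk_comp_specMap {C : Type u} [CommRing C] (g : X ⟶ Spec (CommRingCat.of B))
    (φ : C →+* B) (x : X) :
    toStalk (g ≫ Spec.map (CommRingCat.ofHom φ)) x = (toStalk g x).comp φ := by
  have h : (Scheme.ΓSpecIso (CommRingCat.of C)).inv ≫
      (g ≫ Spec.map (CommRingCat.ofHom φ)).appTop ≫ X.presheaf.germ ⊤ x trivial =
      CommRingCat.ofHom φ ≫ (Scheme.ΓSpecIso (CommRingCat.of B)).inv ≫ g.appTop ≫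
        X.presheaf.germ ⊤ x trivial := by
    rw [Scheme.ΓSpecIso_inv_naturality_assoc, Scheme.Hom.comp_appTop, Category.assoc]
  exact congrArg CommRingCat.Hom.hom h

theorem isLocalization_toStalk (g : X ⟶ Spec (CommRingCat.of B)) [IsOpenImmersion g] (x : X) :
    letI := (toStalk g x).toAlgebra
    letI y : PrimeSpectrum B := g x
    IsLocalization.AtPrime (X.presheaf.stalk x) y.asIdeal := by
  let := (toStalk g x).toAlgebra
  let y : PrimeSpectrum B := g x
  let : Algebra B ((Spec (CommRingCat.of B)).presheaf.stalk (g x)) :=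
    StructureSheaf.stalkAlgebra B y
  have : IsLocalization.AtPrime ((Spec (CommRingCat.of B)).presheaf.stalk (g x)) y.asIdeal :=
    StructureSheaf.IsLocalization.to_stalk B y
  exact IsLocalization.isLocalization_of_algEquiv y.asIdeal.primeCompl
    (AlgEquiv.ofRingEquiv (f := (asIso (g.stalkMap x)).commRingCatIsoToRingEquiv) fun b => by
      have h : (Scheme.ΓSpecIso (CommRingCat.of B)).inv ≫
          (Spec (CommRingCat.of B)).presheaf.germ ⊤ (g x) trivial ≫ g.stalkMap x =
          (Scheme.ΓSpecIso (CommRingCat.of B)).inv ≫ g.appTop ≫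
            X.presheaf.germ ⊤ x trivial :=
        congrArg _ (Scheme.Hom.germ_stalkMap g ⊤ x trivial)
      exact congrArg (fun φ => φ.hom b) h)

end Stalks

section PinchedCurve

variable {k : Type u} [Field k] {s N : ℕ} {B : Subalgebra k (Fin s → k[X])} {X : Scheme.{u}}
  {f : X ⟶ Spec (CommRingCat.of k)}

theorem IsPinched.schemeHasBranchesAndDelta (hB : IsPinched N B) (i : Fin s)
    (e : X ≅ Spec (CommRingCat.of B)) (he : e.hom ≫ specStructure k B = f) {x : X}
    (hx : (e.hom x).asIdeal = RingHom.ker (constCoeff B i)) :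
    SchemeHasBranchesAndDelta f x s
      (Module.finrank k ((Fin s → k[X]) ⧸ Subalgebra.toSubmodule B)) := by
  let : Algebra k (X.presheaf.stalk x) := (stalkStructure f x).toAlgebra
  let : Algebra B (X.presheaf.stalk x) := (toStalk e.hom x).toAlgebra
  have : IsScalarTower k B (X.presheaf.stalk x) :=
    .of_algebraMap_eq' <| by
      subst he
      exact toStalk_comp_specMap e.hom (algebraMap k B) x
  let y : PrimeSpectrum B := e.hom x
  have := isLocalization_toStalk e.hom x
  exact hB.hasBranchesAndDelta_of_isLocalization i y.asIdeal hx

theorem IsPinched.isConnectedAffineCurve (hB : IsPinched N B) (i : Fin s)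
    (e : X ≅ Spec (CommRingCat.of B)) (he : e.hom ≫ specStructure k B = f) :
    IsConnectedAffineCurve f where
  isAffine := .of_isIso e.hom
  finiteType := by
    have : LocallyOfFiniteType (specStructure k B) := by
      rw [specStructure, HasRingHomProperty.Spec_iff (P := @LocallyOfFiniteType)]
      exact RingHom.finiteType_algebraMap.2 hB.finiteType
    rw [← he]
    infer_instance
  isReduced := by
    have : IsReduced B := isReduced_of_injective B.val Subtype.val_injective
    exact isReduced_of_isOpenImmersion e.hom
  connected := by
    have : ConnectedSpace (Spec (CommRingCat.of B)) := hB.connectedSpace i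
    exact e.hom.homeomorph.connectedSpace_iff.2 this
  dim_eq_one Z hZ := by
    let h := e.hom.homeomorph
    have hZ' : h '' Z ∈ irreducibleComponents (PrimeSpectrum B) :=
      image_mem_irreducibleComponents_of_isPreirreducible_fiber h h.continuous h.isOpenMap
        (fun x => (Set.subsingleton_singleton.preimage h.injective).isPreirreducible)
        h.surjective hZ
    rw [← hB.topologicalKrullDim_eq_one _ hZ']
    exact IsHomeomorph.topologicalKrullDim_eq _ (h.image Z).isHomeomorph

end PinchedCurve

section Smooth

/-- The family `f` is smooth away from the image of `σ`. The complement of the image is required to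
be open. -/
def IsSmoothOff {X S T : Scheme.{u}} (f : X ⟶ S) (σ : T ⟶ X) : Prop :=
  ∃ U : X.Opens, (U : Set X) = (Set.range σ)ᶜ ∧ Smooth (U.ι ≫ f)

theorem IsSmoothOff.of_iso {X Y S T : Scheme.{u}} {f : X ⟶ S} {σ : T ⟶ X} (h : IsSmoothOff f σ)
    (e : Y ≅ X) : IsSmoothOff (e.hom ≫ f) (σ ≫ e.inv) := by
  obtain ⟨U, hU, hsmooth⟩ := h
  refine ⟨e.hom ⁻¹ᵁ U, ?_, ?_⟩
  · have hrange : Set.range (σ ≫ e.inv) = e.hom ⁻¹' Set.range σ := by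
      rw [Scheme.Hom.comp_base, TopCat.coe_comp, Set.range_comp]
      exact congrFun (Set.image_eq_preimage_of_inverse (Scheme.inv_hom_apply e)
        (Scheme.hom_inv_apply e)) _
    rw [hrange, ← Set.preimage_compl, ← hU]
    rfl
  · rw [← morphismRestrict_ι_assoc]
    infer_instance

theorem smooth_ι_comp_of_eq_iUnion_range {X S : Scheme.{u}} {I : Type} {V : I → Scheme.{u}}
    {f : X ⟶ S} {U : X.Opens} (j : ∀ i, V i ⟶ X) [∀ i, IsOpenImmersion (j i)]
    (hU : (U : Set X) = ⋃ i, Set.range (j i)) (hj : ∀ i, Smooth (j i ≫ f)) :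
    Smooth (U.ι ≫ f) := by
  have hle (i : I) : Set.range (j i) ⊆ Set.range U.ι := by
    rw [Scheme.Opens.range_ι, hU]
    exact Set.subset_iUnion (fun i => Set.range (j i)) i
  let 𝒰 : Scheme.OpenCover.{0} U := Scheme.Cover.mkOfCovers I V
    (fun i => IsOpenImmersion.lift U.ι (j i) (hle i))
    (fun x => by
      obtain ⟨i, y, hy⟩ := Set.mem_iUnion.1 (hU.le x.2)
      refine ⟨i, y, U.ι.injective ?_⟩
      rw [← Scheme.Hom.comp_apply, IsOpenImmersion.lift_fac, hy]
      rfl)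
    fun i => inferInstance
  have := HasRingHomProperty.instIsZariskiLocalAtSource (P := @Smooth.{u})
  refine IsZariskiLocalAtSource.of_openCover (P := @Smooth) 𝒰 fun i => ?_
  change Smooth (IsOpenImmersion.lift U.ι (j i) (hle i) ≫ U.ι ≫ f)
  rw [IsOpenImmersion.lift_fac_assoc]
  exact hj i

theorem smooth_algebraMap_laurentPolynomial (K : Type*) [CommRing K] :
    (algebraMap K K[T;T⁻¹]).Smooth := by
  have : Algebra.Smooth K K[X] := { }
  have halg : algebraMap K K[T;T⁻¹] = (algebraMap K[X] K[T;T⁻¹]).comp (algebraMap K K[X]) :=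
    RingHom.ext fun c => (Polynomial.toLaurent_C c).symm
  exact halg ▸ (RingHom.smooth_algebraMap.2 this).comp
    (RingHom.Smooth.holdsForLocalizationAway K[T;T⁻¹] (Polynomial.X : K[X]))

variable {K : Type u} {ι : Type} [CommRing K] (B : Subalgebra K (ι → K[X])) (i : ι)

/-- The section of `Spec B ⟶ Spec K` through the pinched origins. -/
def pinchSection : Spec (CommRingCat.of K) ⟶ Spec (CommRingCat.of B) :=
  Spec.map (CommRingCat.ofHom (constCoeff B i).toRingHom)

theorem pinchSection_comp :
    pinchSection B i ≫ Spec.map (CommRingCat.ofHom (algebraMap K B)) = 𝟙 _ := by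
  have h : (constCoeff B i).toRingHom.comp (algebraMap K B) = RingHom.id K :=
    (constCoeff B i).comp_algebraMap
  rw [pinchSection, ← Spec.map_comp, ← CommRingCat.ofHom_comp, h, CommRingCat.ofHom_id, Spec.map_id]

theorem range_pinchSection : Set.range (pinchSection B i) =
    PrimeSpectrum.zeroLocus (RingHom.ker (constCoeff B i) : Set B) :=
  range_comap_of_surjective _ (constCoeff B i).toRingHom constCoeff_surjective

variable {B}

theorem IsPinched.compl_zeroLocus_ker_constCoeff [DecidableEq ι] [Finite ι] {N : ℕ}
    (hB : IsPinched N B) :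
    (PrimeSpectrum.zeroLocus (RingHom.ker (constCoeff B i) : Set B))ᶜ =
      ⋃ j, (PrimeSpectrum.basicOpen (hB.branchCoord j) : Set (PrimeSpectrum B)) := by
  ext p
  rw [Set.mem_iUnion]
  constructor
  · intro hp
    by_contra! h
    exact hp fun f hf => hB.mem_of_branchCoord_mem p.2 (fun j => not_not.1 (h j)) hf
  · rintro ⟨j, hj⟩ hp
    exact hj (hp (hB.constCoeff_branchCoord i j))

theorem IsPinched.isOpenImmersion_branchChart {N : ℕ} (hB : IsPinched N B) :
    IsOpenImmersion (Spec.map (CommRingCat.ofHom (branchChart B i).toRingHom)) := by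
  classical
  let := (branchChart B i).toRingHom.toAlgebra
  have := hB.isLocalization_branchChart i
  exact IsOpenImmersion.of_isLocalization (hB.branchCoord i)

theorem IsPinched.range_branchChart [DecidableEq ι] {N : ℕ} (hB : IsPinched N B) :
    Set.range (Spec.map (CommRingCat.ofHom (branchChart B i).toRingHom)) =
      (PrimeSpectrum.basicOpen (hB.branchCoord i) : Set (PrimeSpectrum B)) :=
  let := (branchChart B i).toRingHom.toAlgebra
  have := hB.isLocalization_branchChart i
  PrimeSpectrum.localization_away_comap_range K[T;T⁻¹] (hB.branchCoord i)

theorem IsPinched.compl_range_pinchSection [Finite ι] {N : ℕ} (hB : IsPinched N B) :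
    (Set.range (pinchSection B i))ᶜ =
      ⋃ j, Set.range (Spec.map (CommRingCat.ofHom (branchChart B j).toRingHom)) := by
  classical
  rw [Set.iUnion_congr hB.range_branchChart, range_pinchSection]
  exact hB.compl_zeroLocus_ker_constCoeff i

theorem IsPinched.isSmoothOff [Finite ι] {N : ℕ} (hB : IsPinched N B) :
    IsSmoothOff (Spec.map (CommRingCat.ofHom (algebraMap K B))) (pinchSection B i) := by
  have := hB.isOpenImmersion_branchChart
  have hcompl := hB.compl_range_pinchSection i
  refine ⟨⟨(Set.range (pinchSection B i))ᶜ, ?_⟩, rfl, smooth_ι_comp_of_eq_iUnion_range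
    (fun j => Spec.map (CommRingCat.ofHom (branchChart B j).toRingHom)) hcompl fun j => ?_⟩
  · rw [hcompl]
    exact isOpen_iUnion fun j => (Scheme.Hom.isOpenEmbedding _).isOpen_range
  · rw [← Spec.map_comp, ← CommRingCat.ofHom_comp, HasRingHomProperty.Spec_iff (P := @Smooth)]
    exact (branchChart B j).comp_algebraMap ▸ smooth_algebraMap_laurentPolynomial K

end Smooth

theorem flat_subalgebra {R S : Type*} [CommRing R] [IsDedekindDomain R] [CommRing S] [Algebra R S]
    [Module.IsTorsionFree R S] (B : Subalgebra R S) : Module.Flat R B :=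
  inferInstance

theorem isPushout_of_surjective {P Q K D : Type u} [CommRing P] [CommRing Q] [CommRing K]
    [CommRing D] (f : P →+* Q) (g : P →+* K) (inl : Q →+* D) (inr : K →+* D)
    (hcomm : inl.comp f = inr.comp g) (hg : Function.Surjective g)
    (hinl : Function.Surjective inl) (hker : RingHom.ker inl ≤ (RingHom.ker g).map f) :
    IsPushout (CommRingCat.ofHom f) (CommRingCat.ofHom g) (CommRingCat.ofHom inl)
      (CommRingCat.ofHom inr) := by
  have hepig : Epi (CommRingCat.ofHom g) := ConcreteCategory.epi_of_surjective _ hg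
  have hepil : Epi (CommRingCat.ofHom inl) := ConcreteCategory.epi_of_surjective _ hinl
  have hw : CommRingCat.ofHom f ≫ CommRingCat.ofHom inl =
      CommRingCat.ofHom g ≫ CommRingCat.ofHom inr := congrArg CommRingCat.ofHom hcomm
  have hdesc (c : PushoutCocone (CommRingCat.ofHom f) (CommRingCat.ofHom g)) :
      RingHom.ker inl ≤ RingHom.ker c.inl.hom := by
    refine hker.trans (Ideal.map_le_iff_le_comap.2 fun x hx => ?_)
    have h : c.inl.hom (f x) = c.inr.hom (g x) := congrArg (fun φ => φ.hom x) c.condition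
    rw [Ideal.mem_comap, RingHom.mem_ker, h, RingHom.mem_ker.1 hx, map_zero]
  let desc (c : PushoutCocone (CommRingCat.ofHom f) (CommRingCat.ofHom g)) :
      CommRingCat.of D ⟶ c.pt :=
    CommRingCat.ofHom (inl.liftOfSurjective hinl ⟨c.inl.hom, hdesc c⟩)
  have hinldesc (c) : CommRingCat.ofHom inl ≫ desc c = c.inl := by
    ext x
    exact RingHom.liftOfRightInverse_comp_apply inl _ (Function.rightInverse_surjInv hinl) _ x
  refine ⟨⟨hw⟩, ⟨PushoutCocone.IsColimit.mk _ desc hinldesc (fun c => ?_) fun c m hm _ => ?_⟩⟩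
  · rw [← cancel_epi (CommRingCat.ofHom g), ← Category.assoc, ← hw, Category.assoc, hinldesc,
      c.condition]
  · rw [← cancel_epi (CommRingCat.ofHom inl), hm, hinldesc]

section Family

variable {k : Type u} [Field k] {s N : ℕ} (A : Subalgebra k (Fin s → k[X])) (w : Fin s → ℕ)
  (b : k) (i : Fin s)

/-- The family over the affine line with coordinate ring `reesModel A w`. -/
abbrev modelFamily : Spec (CommRingCat.of (reesModel A w)) ⟶ affineLine k :=
  Spec.map (CommRingCat.ofHom (algebraMap k[X] (reesModel A w)))

/-- The Rees degeneration in the coordinates `t`, `y_i = x_i t ^ (-w_i)`. -/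
def reesTotalIso : reesTotal A w ≅ Spec (CommRingCat.of (reesModel A w)) :=
  Scheme.Spec.mapIso (reesEquiv A w).symm.toCommRingCatIso.op

theorem reesTotalIso_hom_comp : (reesTotalIso A w).hom ≫ modelFamily A w = reesFamily A w := by
  have h : (reesEquiv A w).symm.toRingHom.comp (algebraMap k[X] (reesModel A w)) =
      (reesParameter (weightFiltration A w)).toRingHom :=
    RingHom.ext fun q => (reesEquiv A w).symm_apply_eq.2 (reesEquiv_reesParameter q).symm
  rw [reesFamily, ← h]
  exact (Spec.map_comp _ _).symm

theorem flat_reesFamily : Flat (reesFamily A w) := by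
  have : Flat (modelFamily A w) :=
    Flat.SpecMap_iff.2 (RingHom.flat_algebraMap_iff.2 (flat_subalgebra (reesModel A w)))
  rw [← reesTotalIso_hom_comp]
  infer_instance

variable {A} in
theorem locallyOfFinitePresentation_reesFamily (hA : IsPinched N A) :
    LocallyOfFinitePresentation (reesFamily A w) := by
  have : LocallyOfFinitePresentation (modelFamily A w) := by
    have := (isPinched_reesModel (w := w) hA).finiteType
    rw [HasRingHomProperty.Spec_iff (P := @LocallyOfFinitePresentation)]
    exact RingHom.finitePresentation_algebraMap.2 (Algebra.FinitePresentation.of_finiteType.1 this)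
  rw [← reesTotalIso_hom_comp]
  infer_instance

/-- The inclusion of the fibre over `t = b` into the total space of the Rees degeneration. -/
def reesFibreInclusion : Spec (CommRingCat.of (reesFibre A w b)) ⟶ reesTotal A w :=
  Spec.map (CommRingCat.ofHom (toReesFibre A w b)) ≫ (reesTotalIso A w).inv

theorem isPullback_modelFamily :
    IsPullback (Spec.map (CommRingCat.ofHom (toReesFibre A w b)))
      (specStructure k (reesFibre A w b)) (modelFamily A w) (linePoint k b) := by
  refine isPullback_SpecMap_of_isPushout _ _ _ _ (isPushout_of_surjective _ _ _ _
    (RingHom.ext toReesFibre_algebraMap) (fun c => ⟨Polynomial.C c, by simp⟩)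
    toReesFibre_surjective ?_)
  rw [ker_toReesFibre, Ideal.span_singleton_le_iff_mem]
  exact Ideal.mem_map_of_mem _ (by simp [RingHom.mem_ker])

theorem isPullback_reesFamily :
    IsPullback (reesFibreInclusion A w b) (specStructure k (reesFibre A w b)) (reesFamily A w)
      (linePoint k b) :=
  (isPullback_modelFamily A w b).of_iso (Iso.refl _) (reesTotalIso A w).symm (Iso.refl _)
    (Iso.refl _) (by simp [reesFibreInclusion]) (by simp) (by simp [← reesTotalIso_hom_comp])
    (by simp)

/-- The fibre of the Rees degeneration over `t = b` is the spectrum of `reesFibre A w b`. -/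
def reesFibreIso : fibre (reesFamily A w) b ≅ Spec (CommRingCat.of (reesFibre A w b)) :=
  (isPullback_reesFamily A w b).isoPullback.symm

theorem reesFibreIso_hom_comp : (reesFibreIso A w b).hom ≫ specStructure k (reesFibre A w b) =
    fibreStructure (reesFamily A w) b :=
  (isPullback_reesFamily A w b).isoPullback_inv_snd

/-- The section of the Rees degeneration through the pinched points of the fibres. -/
def reesSection : affineLine k ⟶ reesTotal A w :=
  pinchSection (reesModel A w) i ≫ (reesTotalIso A w).inv

theorem reesSection_comp : reesSection A w i ≫ reesFamily A w = 𝟙 (affineLine k) := by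
  rw [reesSection, ← reesTotalIso_hom_comp, Category.assoc, Iso.inv_hom_id_assoc]
  exact pinchSection_comp (reesModel A w) i

variable {A} in
theorem isSmoothOff_reesSection (hA : IsPinched N A) :
    IsSmoothOff (reesFamily A w) (reesSection A w i) := by
  rw [← reesTotalIso_hom_comp]
  exact ((isPinched_reesModel hA).isSmoothOff i).of_iso (reesTotalIso A w)

variable {A w b} in
theorem constCoeff_toReesFibre (g : reesModel A w) :
    constCoeff (reesFibre A w b) i (toReesFibre A w b g) =
      (constCoeff (reesModel A w) i g).eval b := by
  rw [constCoeff_apply, constCoeff_apply]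
  exact coeff_specialize b g.1 i 0

theorem pinchSection_comp_reesFibreInclusion :
    pinchSection (reesFibre A w b) i ≫ reesFibreInclusion A w b =
      linePoint k b ≫ reesSection A w i := by
  have h : (constCoeff (reesFibre A w b) i).toRingHom.comp (toReesFibre A w b) =
      (Polynomial.evalRingHom b).comp (constCoeff (reesModel A w) i).toRingHom :=
    RingHom.ext (constCoeff_toReesFibre i)
  rw [reesFibreInclusion, reesSection, pinchSection, pinchSection, linePoint, ← Category.assoc,
    ← Category.assoc, ← Spec.map_comp, ← Spec.map_comp, ← CommRingCat.ofHom_comp,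
    ← CommRingCat.ofHom_comp, h]

theorem sectionPoint_comp_reesFibreIso_hom :
    sectionPoint (reesFamily A w) (reesSection A w i) (reesSection_comp A w i) b ≫
      (reesFibreIso A w b).hom = pinchSection (reesFibre A w b) i := by
  have h := isPullback_reesFamily A w b
  rw [← Iso.eq_comp_inv]
  apply pullback.hom_ext
  · rw [sectionPoint, pullback.lift_fst, Category.assoc]
    exact (pinchSection_comp_reesFibreInclusion A w b i).symm.trans
      (congrArg _ h.isoPullback_hom_fst.symm)
  · rw [sectionPoint, pullback.lift_snd, Category.assoc]
    exact (pinchSection_comp (reesFibre A w b) i).symm.trans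
      (congrArg _ h.isoPullback_hom_snd.symm)

theorem asIdeal_sectionAt_reesSection :
    ((reesFibreIso A w b).hom
      (sectionAt (reesFamily A w) (reesSection A w i) (reesSection_comp A w i) b)).asIdeal =
      RingHom.ker (constCoeff (reesFibre A w b) i) := by
  have h : (reesFibreIso A w b).hom
      (sectionAt (reesFamily A w) (reesSection A w i) (reesSection_comp A w i) b) =
      pinchSection (reesFibre A w b) i (⊥ : PrimeSpectrum k) :=
    congrArg (fun f => f (⊥ : PrimeSpectrum k)) (sectionPoint_comp_reesFibreIso_hom A w b i)
  rw [h]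
  exact (RingHom.ker_eq_comap_bot _).symm

variable {A} in
theorem schemeHasBranchesAndDelta_reesFamily (hA : IsPinched N A) :
    SchemeHasBranchesAndDelta (fibreStructure (reesFamily A w) b)
      (sectionAt (reesFamily A w) (reesSection A w i) (reesSection_comp A w i) b) s
      (Module.finrank k[X] ((Fin s → k[X][X]) ⧸ (reesModel A w).toSubmodule)) := by
  rw [← finrank_quotient_reesFibre hA b]
  exact (isPinched_reesFibre hA).schemeHasBranchesAndDelta i _ (reesFibreIso_hom_comp A w b)
    (asIdeal_sectionAt_reesSection A w b i)

variable {b} in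
theorem isIsoOver_fibre_of_ne_zero (hb : b ≠ 0) :
    IsIsoOver (fibreStructure (reesFamily A w) b) (specStructure k A) := by
  let e := reesFibreEquiv A w hb
  have he : e.toRingHom.comp (algebraMap k A) = algebraMap k (reesFibre A w b) :=
    RingHom.ext e.commutes
  refine ⟨reesFibreIso A w b ≪≫ Scheme.Spec.mapIso e.toRingEquiv.toCommRingCatIso.op, ?_⟩
  rw [Iso.trans_hom, Category.assoc, ← reesFibreIso_hom_comp, specStructure, specStructure, ← he]
  exact congrArg _ (Spec.map_comp _ _).symm

end Family

end MonomialDegeneration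

end

open MonomialDegeneration in
theorem theorem3p4 {k : Type*} [Field k] [IsAlgClosed k] {s : ℕ}
    (A : Subalgebra k (Fin s → k[X])) (𝔪 : Ideal A) (hA : IsRationalCurve A 𝔪) :
    ∃ w : Fin s → ℕ, (∀ i, 0 < w i) ∧
      Flat (reesFamily A w) ∧
      LocallyOfFinitePresentation (reesFamily A w) ∧
      (∀ b : k, IsConnectedAffineCurve (fibreStructure (reesFamily A w) b)) ∧
      (∃ (σ : affineLine k ⟶ reesTotal A w) (hσ : σ ≫ reesFamily A w = 𝟙 (affineLine k)),
        (∃ U : (reesTotal A w).Opens, (U : Set (reesTotal A w)) = (Set.range σ)ᶜ ∧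
          Smooth (U.ι ≫ reesFamily A w)) ∧
        (∃ δ : ℕ, ∀ b : k, SchemeHasBranchesAndDelta (fibreStructure (reesFamily A w) b)
          (sectionAt (reesFamily A w) σ hσ b) s δ)) ∧
      (∀ b : k, b ≠ 0 → IsIsoOver (fibreStructure (reesFamily A w) b) (specStructure k A)) ∧
      (∃ A₀ : Subalgebra k (Fin s → k[X]), IsMonomialSubring A₀ ∧
        IsNormalizationMap A₀.val.toRingHom ∧
        IsIsoOver (fibreStructure (reesFamily A w) 0) (specStructure k A₀)) := by
  obtain ⟨N, hN⟩ := hA.exists_isPinched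
  let i₀ : Fin s := ⟨0, hA.pos⟩
  let w : Fin s → ℕ := fun i => (N + 1) ^ (i : ℕ)
  have hfibre (b : k) : IsPinched N (reesFibre A w b) := isPinched_reesFibre hN
  have hbranch (b : k) := schemeHasBranchesAndDelta_reesFamily w b i₀ hN
  refine ⟨w, fun i => by positivity, flat_reesFamily A w,
    locallyOfFinitePresentation_reesFamily w hN, fun b => ?_,
    ⟨reesSection A w i₀, reesSection_comp A w i₀, isSmoothOff_reesSection w i₀ hN, _, hbranch⟩,
    fun b hb => isIsoOver_fibre_of_ne_zero A w hb, reesFibre A w 0, ?_, ?_, ?_⟩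
  · exact (hfibre b).isConnectedAffineCurve i₀ _ (reesFibreIso_hom_comp A w b)
  · exact isMonomialSubring_reesFibre_zero hN (separatesMonomials_pow N s) i₀
  · exact (hfibre 0).isNormalizationMap
  · exact ⟨reesFibreIso A w 0, reesFibreIso_hom_comp A w 0⟩
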